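/- Let $S$ be a finite set with at least two elements, let $P=(p_{ik})_{i,k\in S}$ be an irreducible and aperiodic stochastic matrix, and let $\nu$ be a probability distribution on $S$. Let $X^{(1)},X^{(2)},\dots$ be independent Markov chains on one probability space, each with initial law $\nu$ and transition matrix $P$; regard each trajectory as an infinite string over the alphabet $S$. For integers $j\ge 2$ and $m\ge 1$ let $H_{m,j}$ be the height of the $(j-1)$-trie built from $X^{(1)},\dots,X^{(m)}$, that is, the smallest $n\ge 0$ such that every word of length $n$ over $S$ is the prefix of strictly fewer than $j$ of these $m$ strings. (The case in which $\nu$ is a row $(p_{1k})_{k\in S}$ of $P$ corresponds to chains started from the fixed state $1$, whose initial state is not recorded.) Call an eigenvalue of a matrix a maximum modulus eigenvalue if it is a simple root of the characteristic polynomial and its modulus is strictly larger than that of every other root. Then, for every $j\ge 2$, the matrix $A(j)=(p_{ik}^{\,j})_{i,k\in S}$ has a maximum modulus eigenvalue $\rho(j)$, it satisfies $0<\rho(j)<1$, almost surely $H_{m,j}$ is finite for all $m$, and $$\lim_{m\to\infty}\frac{H_{m,j}}{\ln m}=\frac{j}{-\ln\rho(j)}\qquad\text{almost surely.}$$ Moreover,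 there is a deterministic constant $C$ such that almost surely, for all sufficiently large $m$ (depending on the realization), $$\frac{H_{m,j}}{\ln m}\le\frac{j}{-\ln\rho(j)}+C\,\frac{\ln\ln m}{\ln m}.$$ -/

import Mathlib

open MeasureTheory ProbabilityTheory Filter Topology

/-- A transition matrix is aperiodic if, for every state `i`, the greatest common divisor of the
possible return times `{n ≥ 1 | (P ^ n) i i > 0}` is one: the only common divisor is `1`. -/
def IsAperiodic {S : Type*} [Fintype S] [DecidableEq S] (P : Matrix S S ℝ) : Prop :=
  ∀ i : S, ∀ d : ℕ, (∀ n : ℕ, 1 ≤ n → 0 < (P ^ n) i i → d ∣ n) → d = 1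

/-- `X` is a Markov chain with initial law `ν` and transition matrix `P` under `μ`: every path
`w 0, …, w n` has probability `ν (w 0) * P (w 0) (w 1) * ⋯ * P (w (n - 1)) (w n)`. -/
structure IsMarkovChain {Ω S : Type*} [MeasurableSpace Ω] [MeasurableSpace S]
    (μ : Measure Ω) (ν : S → ℝ) (P : Matrix S S ℝ) (X : ℕ → Ω → S) : Prop where
  measurable : ∀ t, Measurable (X t)
  path_law : ∀ (n : ℕ) (w : ℕ → S),
    μ {ω | ∀ t ≤ n, X t ω = w t} =
      ENNReal.ofReal (ν (w 0) * ∏ t ∈ Finset.range n, P (w t) (w (t + 1)))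

/-- A maximum modulus eigenvalue of a matrix: a simple root of the characteristic polynomial
whose modulus is strictly larger than the modulus of every other root. -/
def IsMaxModulusEigenvalue {S : Type*} [Fintype S] [DecidableEq S]
    (A : Matrix S S ℂ) (r : ℂ) : Prop :=
  A.charpoly.rootMultiplicity r = 1 ∧ ∀ z : ℂ, A.charpoly.IsRoot z → z ≠ r → ‖z‖ < ‖r‖

/-- The number of balls in the box `u` of generation `n` when `m` balls have been thrown: the
number of the first `m` strings `X 0, …, X (m - 1)` whose first `n` letters form the word `u`. -/
def ballCount {Ω S : Type*} [DecidableEq S] (X : ℕ → ℕ → Ω → S) (m n : ℕ)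
    (u : Fin n → S) (ω : Ω) : ℕ :=
  ((Finset.range m).filter fun k => ∀ t : Fin n, X k t ω = u t).card

/-- Every box of generation `n` contains strictly less than `j` of the first `m` balls. -/
def AllBoxesLt {Ω S : Type*} [DecidableEq S] (X : ℕ → ℕ → Ω → S) (m j n : ℕ) (ω : Ω) : Prop :=
  ∀ u : Fin n → S, ballCount X m n u ω < j

/-- The height of the `(j - 1)`-trie built from the first `m` strings: the first generation at
which all boxes contain strictly less than `j` balls (`0` if there is no such generation). -/
noncomputable def trieHeight {Ω S : Type*} [DecidableEq S] (X : ℕ → ℕ → Ω → S) (m j : ℕ)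
    (ω : Ω) : ℕ :=
  sInf {n : ℕ | AllBoxesLt X m j n ω}

/-! The quantity that governs the height is `∑ w, wordProb ν P n w ^ j`, the probability that `j`
independent chains share their first `n` letters. Weighted by a positive eigenvector of the
entrywise power of `P`, this sum satisfies an exact recursion in `n`, so it lies between two
positive multiples of `ρ ^ n` (`sum_wordProb_pow_bounds`). Among `m` strings, the expected number of
`j`-subsets with a common prefix of length `n` is therefore of order `m ^ j * ρ ^ n`, which passes
from large to small near `n = j * log m / (-log ρ)`.

Beyond this threshold a union bound rules out full boxes (`measureReal_not_allBoxesLt_le`). Before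
it, the strings are split into `j` groups and one counts the choices of one string per group that
agree on a word. Independence of the groups makes the first two moments factor, and Chebyshev shows
that the count is rarely zero (`measureReal_no_common_value_le`). Both bounds enter Borel–Cantelli
along a geometric sequence of `m`, and monotonicity of the boxes in `m` and `n` fills the gaps. A
slack of order `log k` at `m = 2 ^ k` suffices above, whence the `log log m` error; below, a factor
`1 - ε` is given up.

The spectral part is Perron–Frobenius: a positive right eigenvector comes from a Collatz–Wielandt
maximum, and pairing with a positive left eigenvector gives dominance, simplicity and `ρ < 1`. -/

/-! ### Primitive matrices and their positive eigenvectors. -/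

section PerronFrobenius

variable {n : Type*} [Fintype n] [DecidableEq n]

lemma Matrix.pow_apply_pos_of_imp {A B : Matrix n n ℝ} (hA : ∀ i k, 0 ≤ A i k)
    (hB : ∀ i k, 0 ≤ B i k) (h : ∀ i k, 0 < A i k → 0 < B i k) (m : ℕ) (i k : n)
    (hm : 0 < (A ^ m) i k) : 0 < (B ^ m) i k := by
  induction m generalizing k with
  | zero => simpa using hm
  | succ m ih =>
    rw [pow_succ, Matrix.mul_apply] at hm ⊢
    obtain ⟨l, -, hl⟩ := (Finset.sum_pos_iff_of_nonneg
      (fun x _ => mul_nonneg (Matrix.pow_apply_nonneg hA m i x) (hA x k))).1 hm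
    refine (Finset.sum_pos_iff_of_nonneg
      (fun x _ => mul_nonneg (Matrix.pow_apply_nonneg hB m i x) (hB x k))).2
      ⟨l, Finset.mem_univ l, mul_pos (ih l ?_) (h l k ?_)⟩
    · exact pos_of_mul_pos_left hl (hA l k)
    · exact pos_of_mul_pos_right hl (Matrix.pow_apply_nonneg hA m i l)

lemma Matrix.pow_add_apply_pos {A : Matrix n n ℝ} (hA : ∀ i k, 0 ≤ A i k) {a b : ℕ} {i l k : n}
    (h₁ : 0 < (A ^ a) i l) (h₂ : 0 < (A ^ b) l k) : 0 < (A ^ (a + b)) i k := by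
  rw [pow_add, Matrix.mul_apply]
  exact (Finset.sum_pos_iff_of_nonneg
    (fun x _ => mul_nonneg (Matrix.pow_apply_nonneg hA a i x)
      (Matrix.pow_apply_nonneg hA b x k))).2 ⟨l, Finset.mem_univ l, mul_pos h₁ h₂⟩

/-- An irreducible aperiodic matrix is primitive. -/
theorem IsAperiodic.isPrimitive {A : Matrix n n ℝ} (haper : IsAperiodic A)
    (hirr : A.IsIrreducible) : A.IsPrimitive := by
  have hA := hirr.nonneg
  have hev : ∀ i, ∃ N, ∀ m ≥ N, 0 < (A ^ m) i i := by
    intro i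
    let s : Set ℕ := {m | 1 ≤ m ∧ 0 < (A ^ m) i i}
    have hgcd : Nat.setGcd s = 1 :=
      haper i _ fun m h1 h2 => Nat.setGcd_dvd_of_mem (s := s) ⟨h1, h2⟩
    -- Return times are closed under addition, and an additive semigroup of naturals contains all
    -- large multiples of its gcd.
    obtain ⟨N, hN⟩ := Nat.exists_mem_closure_of_ge s
    refine ⟨N, fun m hm => ?_⟩
    refine AddSubmonoid.closure_induction (motive := fun m _ => 0 < (A ^ m) i i)
      (fun x hx => hx.2) (by simp)
      (fun x y _ _ hx hy => Matrix.pow_add_apply_pos hA hx hy) (hN m hm (by simp [hgcd]))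
  choose N hN using hev
  choose k hk0 hk using (Matrix.isIrreducible_iff_exists_pow_pos hA).1 hirr
  -- One exponent for all pairs: loop at `i` for at least `N i` steps, then go to `l` in `k i l`
  -- steps.
  refine ⟨hA, ∑ i, N i + ∑ i, ∑ l, k i l + 1, by omega, fun i l => ?_⟩
  have h1 : N i ≤ ∑ i, N i := Finset.single_le_sum (fun _ _ => Nat.zero_le _) (Finset.mem_univ i)
  have h2 : k i l ≤ ∑ l, k i l :=
    Finset.single_le_sum (f := k i) (fun _ _ => Nat.zero_le _) (Finset.mem_univ l)
  have h3 : ∑ l, k i l ≤ ∑ i, ∑ l, k i l :=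
    Finset.single_le_sum (f := fun i => ∑ l, k i l) (fun _ _ => Nat.zero_le _) (Finset.mem_univ i)
  have := Matrix.pow_add_apply_pos hA (hN i (∑ i, N i + ∑ i, ∑ l, k i l + 1 - k i l) (by omega))
    (hk i l)
  rwa [Nat.sub_add_cancel (by omega)] at this

lemma Matrix.mulVec_pos {n : Type*} [Fintype n] {A : Matrix n n ℝ} (hA : ∀ i k, 0 < A i k) {x : n → ℝ}
    (hx : ∀ i, 0 ≤ x i) (hx0 : x ≠ 0) (i : n) : 0 < (A.mulVec x) i := by
  obtain ⟨l, hl⟩ := Function.ne_iff.1 hx0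
  exact (Finset.sum_pos_iff_of_nonneg fun k _ => mul_nonneg (hA i k).le (hx k)).2
    ⟨l, Finset.mem_univ l, mul_pos (hA i l) ((hx l).lt_of_ne' hl)⟩

lemma Matrix.pow_mulVec_of_eigen {R : Type*} [CommRing R] {A : Matrix n n R} {x : n → R} {r : R}
    (h : A.mulVec x = r • x) (m : ℕ) : (A ^ m).mulVec x = r ^ m • x := by
  induction m with
  | zero => simp
  | succ m ih => rw [pow_succ, ← Matrix.mulVec_mulVec, h, Matrix.mulVec_smul, ih, smul_smul,
      pow_succ']

/-- A nonnegative nonzero eigenvector of a primitive matrix is positive, and so is its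
eigenvalue. -/
lemma Matrix.IsPrimitive.eigenvector_pos {A : Matrix n n ℝ} (hA : A.IsPrimitive) {x : n → ℝ}
    {r : ℝ} (hx : ∀ i, 0 ≤ x i) (hx0 : x ≠ 0) (hr : 0 ≤ r) (h : A.mulVec x = r • x) :
    0 < r ∧ ∀ i, 0 < x i := by
  obtain ⟨hA0, N, hN, hpos⟩ := hA
  have key : ∀ i, 0 < r ^ N * x i := fun i => by
    have := Matrix.mulVec_pos hpos hx hx0 i
    rwa [Matrix.pow_mulVec_of_eigen h] at this
  refine ⟨?_, fun i => pos_of_mul_pos_right (key i) (pow_nonneg hr N)⟩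
  obtain ⟨l, hl⟩ := Function.ne_iff.1 hx0
  refine hr.lt_of_ne' ?_
  rintro rfl
  simpa [hN.ne'] using key l

/-- **Perron's theorem**: a primitive matrix has a positive eigenvector. -/
theorem Matrix.IsPrimitive.exists_pos_eigenvector [Nonempty n] {A : Matrix n n ℝ}
    (hA : A.IsPrimitive) :
    ∃ r : ℝ, 0 < r ∧ ∃ v : n → ℝ, (∀ i, 0 < v i) ∧ A.mulVec v = r • v := by
  have hA0 := hA.nonneg
  let M := ∑ i, ∑ k, A i k
  -- The Collatz–Wielandt set; the cap `M` on the first coordinate is automatic (`hmemK`) and only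
  -- makes the set compact.
  let K : Set (ℝ × (n → ℝ)) :=
    (Set.Icc 0 M ×ˢ stdSimplex ℝ n) ∩ {p | ∀ i, p.1 * p.2 i ≤ (A.mulVec p.2) i}
  have hcont : Continuous fun p : ℝ × (n → ℝ) => A.mulVec p.2 :=
    Continuous.matrix_mulVec continuous_const continuous_snd
  have hKc : IsCompact K := by
    refine (isCompact_Icc.prod (isCompact_stdSimplex ℝ n)).inter_right ?_
    simp only [Set.ofPred_forall]
    refine isClosed_iInter fun i => isClosed_le (by fun_prop) ?_
    exact (continuous_apply i).comp hcont
  have hM : 0 ≤ M := Finset.sum_nonneg fun i _ => Finset.sum_nonneg fun k _ => hA0 i k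
  obtain ⟨i₀⟩ := ‹Nonempty n›
  have hKne : K.Nonempty := by
    refine ⟨(0, Pi.single i₀ 1), ⟨⟨by simp, hM⟩, single_mem_stdSimplex ℝ i₀⟩, fun i => ?_⟩
    simp [hA0]
  have hmemK : ∀ t : ℝ, ∀ x ∈ stdSimplex ℝ n, 0 ≤ t → (∀ i, t * x i ≤ (A.mulVec x) i) →
      (t, x) ∈ K := by
    intro t x hx ht h
    refine ⟨⟨⟨ht, ?_⟩, hx⟩, h⟩
    calc t = ∑ i, t * x i := by rw [← Finset.mul_sum, hx.2, mul_one]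
      _ ≤ ∑ i, (A.mulVec x) i := Finset.sum_le_sum fun i _ => h i
      _ ≤ M := Finset.sum_le_sum fun i _ => Finset.sum_le_sum fun k _ =>
        mul_le_of_le_one_right (hA0 i k)
          (hx.2 ▸ Finset.single_le_sum (fun l _ => hx.1 l) (Finset.mem_univ k))
  obtain ⟨⟨r, x⟩, hp, hmax⟩ := hKc.exists_isMaxOn hKne continuous_fst.continuousOn
  obtain ⟨⟨⟨hr0, -⟩, hx⟩, hrx⟩ := hp
  dsimp only at hr0 hrx
  have hx0 : x ≠ 0 := by
    rintro rfl
    simpa using hx.2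
  have heig : A.mulVec x = r • x := by
    -- Applying `A ^ N` to a nonzero defect `z ≥ 0` makes it positive everywhere, so `y = A ^ N x`
    -- satisfies `A y ≥ (r + e) y` with `e > 0`. After normalization this beats the maximum.
    by_contra hne
    obtain ⟨-, N, -, hpos⟩ := hA
    set z := A.mulVec x - r • x with hz
    have hz0 : z ≠ 0 := sub_ne_zero.2 hne
    have hznn : ∀ i, 0 ≤ z i := fun i => sub_nonneg.2 (hrx i)
    set y := (A ^ N).mulVec x with hy
    have hypos : ∀ i, 0 < y i := Matrix.mulVec_pos hpos hx.1 hx0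
    have hwpos : ∀ i, 0 < ((A ^ N).mulVec z) i := Matrix.mulVec_pos hpos hznn hz0
    have hw : ∀ i, ((A ^ N).mulVec z) i = (A.mulVec y) i - r * y i := fun i => by
      rw [hz, Matrix.mulVec_sub, Matrix.mulVec_smul, Matrix.mulVec_mulVec, ← pow_succ, pow_succ',
        ← Matrix.mulVec_mulVec]
      rfl
    obtain ⟨l, -, hl⟩ := Finset.exists_min_image Finset.univ
      (fun i => ((A ^ N).mulVec z) i / y i) ⟨i₀, Finset.mem_univ i₀⟩
    set e := ((A ^ N).mulVec z) l / y l with he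
    have hepos : 0 < e := div_pos (hwpos l) (hypos l)
    have hYpos : 0 < ∑ i, y i := Finset.sum_pos (fun i _ => hypos i) ⟨i₀, Finset.mem_univ i₀⟩
    have hmem := hmemK (r + e) ((∑ i, y i)⁻¹ • y)
      ⟨fun i => mul_nonneg (inv_nonneg.2 hYpos.le) (hypos i).le, by
        simp [← Finset.mul_sum, hYpos.ne']⟩ (by positivity) (fun i => by
        rw [Matrix.mulVec_smul, Pi.smul_apply, Pi.smul_apply, smul_eq_mul, smul_eq_mul,
          mul_left_comm]
        refine mul_le_mul_of_nonneg_left ?_ (inv_nonneg.2 hYpos.le)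
        have h1 := hl i (Finset.mem_univ i)
        rw [le_div_iff₀ (hypos i), hw i] at h1
        linarith)
    have := hmax hmem
    simp only [Set.mem_ofPred_eq] at this
    linarith
  obtain ⟨h1, h2⟩ := hA.eigenvector_pos hx.1 hx0 hr0 heig
  exact ⟨r, h1, x, h2, heig⟩

lemma Matrix.IsPrimitive.transpose {A : Matrix n n ℝ} (hA : A.IsPrimitive) :
    A.transpose.IsPrimitive := by
  obtain ⟨h0, N, hN, hpos⟩ := hA
  exact ⟨fun i k => h0 k i, N, hN, fun i k => by
    rw [← Matrix.transpose_pow]; exact hpos k i⟩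

/-- A primitive matrix has positive left and right eigenvectors for a common eigenvalue. -/
theorem Matrix.IsPrimitive.exists_pos_eigenvectors [Nonempty n] {A : Matrix n n ℝ}
    (hA : A.IsPrimitive) :
    ∃ r : ℝ, 0 < r ∧ ∃ u v : n → ℝ, (∀ i, 0 < u i) ∧ (∀ i, 0 < v i) ∧
      A.vecMul u = r • u ∧ A.mulVec v = r • v := by
  obtain ⟨r, hr, v, hv, hAv⟩ := hA.exists_pos_eigenvector
  obtain ⟨s, hs, u, hu, hAu⟩ := hA.transpose.exists_pos_eigenvector
  rw [Matrix.mulVec_transpose] at hAu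
  have huv : 0 < u ⬝ᵥ v :=
    Finset.sum_pos (fun i _ => mul_pos (hu i) (hv i)) Finset.univ_nonempty
  have h := Matrix.dotProduct_mulVec u A v
  rw [hAu, hAv, dotProduct_smul, smul_dotProduct, smul_eq_mul, smul_eq_mul] at h
  obtain rfl : r = s := mul_right_cancel₀ huv.ne' h
  exact ⟨r, hr, u, v, hu, hv, hAu, hAv⟩

end PerronFrobenius

/-! ### Dominance and simplicity of the Perron eigenvalue. -/

section PerronFrobenius

variable {n : Type*} [Fintype n] [DecidableEq n]

omit [DecidableEq n] in
/-- If a matrix has a positive left eigenvector for `r`, then a nonzero nonnegative `x` with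
`s x ≤ A x` forces `s ≤ r`, and is an eigenvector if `s = r`. -/
lemma Matrix.le_of_smul_le_mulVec {A : Matrix n n ℝ} {r s : ℝ}
    {u x : n → ℝ} (hu : ∀ i, 0 < u i) (hAu : A.vecMul u = r • u)
    (hx : ∀ i, 0 ≤ x i) (hx0 : x ≠ 0) (h : ∀ i, s * x i ≤ (A.mulVec x) i) :
    s ≤ r ∧ (s = r → A.mulVec x = r • x) := by
  have hux : 0 < u ⬝ᵥ x := by
    obtain ⟨l, hl⟩ := Function.ne_iff.1 hx0
    exact (Finset.sum_pos_iff_of_nonneg fun k _ => mul_nonneg (hu k).le (hx k)).2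
      ⟨l, Finset.mem_univ l, mul_pos (hu l) ((hx l).lt_of_ne' hl)⟩
  -- Pairing the nonnegative defect with `u` gives both claims: the sum is nonnegative, and if it
  -- vanishes so does every term.
  have hsum : ∑ i, u i * ((A.mulVec x) i - s * x i) = (r - s) * u ⬝ᵥ x := by
    have h1 := Matrix.dotProduct_mulVec u A x
    rw [hAu, smul_dotProduct, smul_eq_mul] at h1
    simp only [mul_sub, Finset.sum_sub_distrib]
    rw [sub_mul, ← h1]
    congr 1
    simp only [dotProduct, Finset.mul_sum]
    exact Finset.sum_congr rfl fun i _ => by ring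
  have hnn : ∀ i ∈ Finset.univ, 0 ≤ u i * ((A.mulVec x) i - s * x i) :=
    fun i _ => mul_nonneg (hu i).le (sub_nonneg.2 (h i))
  constructor
  · have := Finset.sum_nonneg hnn
    rw [hsum] at this
    exact sub_nonneg.1 (nonneg_of_mul_nonneg_left this hux)
  · rintro rfl
    rw [sub_self, zero_mul, Finset.sum_eq_zero_iff_of_nonneg hnn] at hsum
    ext i
    have := (mul_eq_zero.1 (hsum i (Finset.mem_univ i))).resolve_left (hu i).ne'
    simpa [sub_eq_zero] using this

omit [DecidableEq n] in
/-- Equality case of the triangle inequality: the summands have a common argument. -/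
lemma Complex.exists_eq_smul_norm_of_norm_sum_eq {z : n → ℂ} (h : ‖∑ i, z i‖ = ∑ i, ‖z i‖) :
    ∃ c : ℂ, ∀ i, z i = c * (‖z i‖ : ℂ) := by
  rcases eq_or_ne (∑ i, z i) 0 with h0 | h0
  · refine ⟨0, fun i => ?_⟩
    rw [h0, norm_zero, eq_comm, Finset.sum_eq_zero_iff_of_nonneg fun _ _ => norm_nonneg _] at h
    simpa using h i (Finset.mem_univ i)
  · set w := ∑ i, z i with hw
    have hwn : (‖w‖ : ℂ) ≠ 0 := by simpa using h0
    set c : ℂ := w / ‖w‖ with hc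
    have hcn : ‖c‖ = 1 := by
      rw [hc, norm_div, Complex.norm_real, norm_norm, div_self (by simpa using h0)]
    have hcc : (starRingEnd ℂ) c * c = 1 := by
      rw [mul_comm, Complex.mul_conj, Complex.normSq_eq_norm_sq, hcn]; norm_num
    refine ⟨c, fun i => ?_⟩
    have hle : ∀ i ∈ Finset.univ, ((starRingEnd ℂ) c * z i).re ≤ ‖z i‖ := fun i _ => by
      refine (Complex.re_le_norm _).trans ?_
      rw [norm_mul, Complex.norm_conj, hcn, one_mul]
    have hsum : ∑ i, ((starRingEnd ℂ) c * z i).re = ∑ i, ‖z i‖ := by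
      rw [← Complex.re_sum, ← Finset.mul_sum, ← hw, ← h]
      have : w = c * ‖w‖ := by rw [hc, div_mul_cancel₀ _ hwn]
      rw [this, ← mul_assoc, hcc, one_mul, Complex.ofReal_re, norm_mul, hcn, one_mul,
        Complex.norm_real, norm_norm]
    have hre := (Finset.sum_eq_sum_iff_of_le hle).1 hsum i (Finset.mem_univ i)
    have hnorm : ‖(starRingEnd ℂ) c * z i‖ = ‖z i‖ := by
      rw [norm_mul, Complex.norm_conj, hcn, one_mul]
    have him : ((starRingEnd ℂ) c * z i) = (‖z i‖ : ℂ) := by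
      rw [← hnorm] at hre ⊢
      exact (Complex.re_eq_norm.1 hre).elim fun _ _ => by
        apply Complex.ext
        · simpa using hre
        · have := (Complex.nonneg_iff.1 (Complex.re_eq_norm.1 hre)).2
          simpa using this.symm
    rw [← him, ← mul_assoc, mul_comm c, hcc, one_mul]

omit [DecidableEq n] in
lemma Matrix.norm_map_mulVec_le {A : Matrix n n ℝ} (hA : ∀ i k, 0 ≤ A i k) (y : n → ℂ) (i : n) :
    ‖((A.map (algebraMap ℝ ℂ)).mulVec y) i‖ ≤ (A.mulVec fun k => ‖y k‖) i := by
  refine (norm_sum_le _ _).trans_eq (Finset.sum_congr rfl fun k _ => ?_)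
  simp [abs_of_nonneg (hA i k)]

/-- A complex eigenvector of a primitive matrix, for an eigenvalue of maximal modulus, is a multiple
of the positive vector of its moduli, and the eigenvalue is the Perron eigenvalue. -/
lemma Matrix.IsPrimitive.eigenvalue_of_le_norm {A : Matrix n n ℝ} (hA : A.IsPrimitive)
    {r : ℝ} {u : n → ℝ} (hr : 0 < r) (hu : ∀ i, 0 < u i) (hAu : A.vecMul u = r • u)
    {z : ℂ} {y : n → ℂ} (hy : y ≠ 0) (hAy : (A.map (algebraMap ℝ ℂ)).mulVec y = z • y)
    (hz : r ≤ ‖z‖) : z = r ∧ ∀ i, y i ≠ 0 := by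
  have hx0 : (fun k => ‖y k‖) ≠ 0 := by
    obtain ⟨l, hl⟩ := Function.ne_iff.1 hy
    exact Function.ne_iff.2 ⟨l, by simpa using hl⟩
  have hxA : ∀ i, ‖z‖ * ‖y i‖ ≤ (A.mulVec fun k => ‖y k‖) i := fun i => by
    rw [← norm_mul, ← smul_eq_mul, ← Pi.smul_apply, ← hAy]
    exact Matrix.norm_map_mulVec_le hA.nonneg y i
  obtain ⟨h1, h2⟩ := Matrix.le_of_smul_le_mulVec hu hAu (fun i => norm_nonneg (y i)) hx0 hxA
  have hzr : ‖z‖ = r := h1.antisymm hz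
  have hAx := h2 hzr
  obtain ⟨-, hpos⟩ := hA.eigenvector_pos (fun i => norm_nonneg (y i)) hx0 hr.le hAx
  have hy0 : ∀ i, y i ≠ 0 := fun i => norm_pos_iff.1 (hpos i)
  refine ⟨?_, hy0⟩
  obtain ⟨l, -⟩ := Function.ne_iff.1 hy
  obtain ⟨hA0, N, -, hN⟩ := hA
  -- Row `l` of `A ^ N` has no zero entry, so equality in the triangle inequality forces a common
  -- phase on all coordinates of `y`.
  have hsum : ‖∑ k, ((A ^ N) l k : ℂ) * y k‖ = ∑ k, ‖((A ^ N) l k : ℂ) * y k‖ := by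
    have e1 : ∑ k, ((A ^ N) l k : ℂ) * y k = z ^ N * y l := by
      have := congrFun (Matrix.pow_mulVec_of_eigen hAy N) l
      rw [← Matrix.map_pow] at this
      simpa [Matrix.mulVec, dotProduct] using this
    have e2 : ∑ k, ‖((A ^ N) l k : ℂ) * y k‖ = r ^ N * ‖y l‖ := by
      have := congrFun (Matrix.pow_mulVec_of_eigen hAx N) l
      simp only [Matrix.mulVec, dotProduct, Pi.smul_apply, smul_eq_mul] at this
      rw [← this]
      refine Finset.sum_congr rfl fun k _ => ?_
      rw [norm_mul, Complex.norm_real, Real.norm_of_nonneg (hN l k).le]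
    rw [e1, e2, norm_mul, norm_pow, hzr]
  obtain ⟨c, hc⟩ := Complex.exists_eq_smul_norm_of_norm_sum_eq hsum
  have hyc : ∀ k, y k = c * (‖y k‖ : ℂ) := fun k => by
    have h := hc k
    rw [norm_mul, Complex.norm_real, Real.norm_of_nonneg (hN l k).le, Complex.ofReal_mul,
      mul_left_comm] at h
    exact mul_left_cancel₀ (by exact_mod_cast (hN l k).ne') h
  have h3 : z * y l = r * y l := by
    have e1 : z * y l = ∑ k, (A l k : ℂ) * y k := by
      have := congrFun hAy l
      simpa [Matrix.mulVec, dotProduct] using this.symm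
    have e2 : ∑ k, (A l k : ℂ) * (‖y k‖ : ℂ) = r * ‖y l‖ := by
      have := congrFun hAx l
      simp only [Matrix.mulVec, dotProduct, Pi.smul_apply, smul_eq_mul] at this
      exact_mod_cast this
    rw [e1]
    calc ∑ k, (A l k : ℂ) * y k = ∑ k, c * ((A l k : ℂ) * (‖y k‖ : ℂ)) :=
          Finset.sum_congr rfl fun k _ => by rw [mul_left_comm, ← hyc k]
      _ = r * y l := by rw [← Finset.mul_sum, e2, mul_left_comm, ← hyc l]
  exact mul_right_cancel₀ (hy0 l) h3

/-- **Perron–Frobenius**: the Perron eigenvalue of a primitive matrix is a simple root of the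
characteristic polynomial, strictly larger in modulus than all other roots. -/
theorem Matrix.IsPrimitive.isMaxModulusEigenvalue [Nonempty n] {A : Matrix n n ℝ}
    (hA : A.IsPrimitive) {r : ℝ} {u v : n → ℝ} (hr : 0 < r) (hu : ∀ i, 0 < u i)
    (hv : ∀ i, 0 < v i) (hAu : A.vecMul u = r • u) (hAv : A.mulVec v = r • v) :
    IsMaxModulusEigenvalue (A.map (algebraMap ℝ ℂ)) (r : ℂ) := by
  set B := A.map (algebraMap ℝ ℂ) with hB
  constructor
  · let φ := Matrix.toLin' B
    let w : n → ℂ := fun i => (v i : ℂ)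
    let u' : n → ℂ := fun i => (u i : ℂ)
    have hBw : B.mulVec w = (r : ℂ) • w := by
      ext i
      have := congrFun hAv i
      simp only [Matrix.mulVec, dotProduct, Pi.smul_apply, smul_eq_mul] at this
      simp only [Matrix.mulVec, dotProduct, Pi.smul_apply, smul_eq_mul, hB, Matrix.map_apply, w,
        Complex.coe_algebraMap]
      exact_mod_cast this
    have hBu : B.vecMul u' = (r : ℂ) • u' := by
      ext i
      have := congrFun hAu i
      simp only [Matrix.vecMul, dotProduct, Pi.smul_apply, smul_eq_mul] at this
      simp only [Matrix.vecMul, dotProduct, Pi.smul_apply, smul_eq_mul, hB, Matrix.map_apply, u',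
        Complex.coe_algebraMap]
      exact_mod_cast this
    have huw : u' ⬝ᵥ w ≠ 0 := by
      have : 0 < u ⬝ᵥ v :=
        Finset.sum_pos (fun i _ => mul_pos (hu i) (hv i)) Finset.univ_nonempty
      simp only [dotProduct] at this
      simp only [dotProduct, u', w]
      exact_mod_cast this.ne'
    have hw0 : w ≠ 0 := by
      rintro h
      simp [h] at huw
    obtain ⟨i₀⟩ := ‹Nonempty n›
    -- Subtracting the multiple of `w` that kills coordinate `i₀` would otherwise leave an
    -- eigenvector with a zero coordinate, which is impossible.
    have hspan : ∀ y : n → ℂ, B.mulVec y = (r : ℂ) • y → y ∈ Submodule.span ℂ {w} := by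
      intro y hy
      refine Submodule.mem_span_singleton.2 ⟨y i₀ / w i₀, ?_⟩
      by_contra hne
      have hd : y - (y i₀ / w i₀) • w ≠ 0 := sub_ne_zero.2 (Ne.symm hne)
      have hAd : B.mulVec (y - (y i₀ / w i₀) • w) = (r : ℂ) • (y - (y i₀ / w i₀) • w) := by
        rw [Matrix.mulVec_sub, Matrix.mulVec_smul, hy, hBw, smul_sub, smul_comm]
      refine (hA.eigenvalue_of_le_norm hr hu hAu hd hAd ?_).2 i₀ ?_
      · simp [abs_of_pos hr]
      · have : w i₀ ≠ 0 := by simpa [w] using (hv i₀).ne'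
        simp [div_mul_cancel₀ _ this]
    -- No Jordan chain: if `(B - r) y = c w`, pairing with the left eigenvector gives `0 = c (u' ⬝ᵥ
    -- w)`, hence `c = 0`.
    have hstep : ∀ y : n → ℂ, φ y - (r : ℂ) • y ∈ Submodule.span ℂ {w} →
        y ∈ Submodule.span ℂ {w} := by
      intro y hy
      obtain ⟨c, hc⟩ := Submodule.mem_span_singleton.1 hy
      have hc' : c • w = B.mulVec y - (r : ℂ) • y := hc
      have h1 := congrArg (fun x => u' ⬝ᵥ x) hc'
      simp only [dotProduct_smul, dotProduct_sub, Matrix.dotProduct_mulVec, hBu,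
        smul_dotProduct, sub_self, smul_eq_mul] at h1
      have hc0 : c = 0 := (mul_eq_zero.1 h1).resolve_right huw
      rw [hc0, zero_smul, eq_comm, sub_eq_zero] at hc'
      exact hspan y hc'
    have hmax : Module.End.maxGenEigenspace φ (r : ℂ) = Submodule.span ℂ {w} := by
      apply le_antisymm
      · intro y hy
        obtain ⟨k, hk⟩ := (Module.End.mem_maxGenEigenspace _ _ _).1 hy
        clear hy
        induction k generalizing y with
        | zero => simp only [pow_zero, Module.End.one_apply] at hk; simp [hk]
        | succ k ih =>
          rw [pow_succ, Module.End.mul_apply] at hk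
          exact hstep y (by simpa using ih hk)
      · rw [Submodule.span_singleton_le_iff_mem, Module.End.mem_maxGenEigenspace]
        refine ⟨1, ?_⟩
        simp [φ, hBw]
    rw [← Matrix.charpoly_toLin', ← LinearMap.finrank_maxGenEigenspace_eq, hmax]
    exact finrank_span_singleton hw0
  · intro z hz hzr
    rw [← Matrix.mem_spectrum_iff_isRoot_charpoly, ← Matrix.spectrum_toLin',
      ← Module.End.hasEigenvalue_iff_mem_spectrum] at hz
    obtain ⟨y, hy⟩ := hz.exists_hasEigenvector
    by_contra hle
    push Not at hle
    rw [Complex.norm_real, Real.norm_of_nonneg hr.le] at hle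
    exact hzr (hA.eigenvalue_of_le_norm hr hu hAu hy.2 ((Matrix.toLin'_apply _ _).symm.trans hy.apply_eq_smul) hle).1

end PerronFrobenius

/-! ### Entrywise powers of a stochastic matrix. -/

section HadamardPower

variable {S : Type*} [Fintype S] [DecidableEq S]

/-- The entrywise power of a matrix. -/
def Matrix.hadamardPow (P : Matrix S S ℝ) (j : ℕ) : Matrix S S ℝ := P.map (· ^ j)

omit [Fintype S] [DecidableEq S] in
@[simp] lemma Matrix.hadamardPow_apply (P : Matrix S S ℝ) (j : ℕ) (i k : S) :
    P.hadamardPow j i k = P i k ^ j := rfl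

/-- Positivity of a matrix power depends only on which entries are positive, and entrywise powers
keep positive entries positive. -/
lemma Matrix.IsPrimitive.hadamardPow {P : Matrix S S ℝ} (hP : P.IsPrimitive) (j : ℕ) :
    (P.hadamardPow j).IsPrimitive := by
  obtain ⟨h0, N, hN, hpos⟩ := hP
  exact ⟨fun i k => pow_nonneg (h0 i k) j, N, hN, fun i k =>
    Matrix.pow_apply_pos_of_imp h0 (fun i k => pow_nonneg (h0 i k) j)
      (fun i k h => pow_pos h j) N i k (hpos i k)⟩

/-- A primitive stochastic matrix on at least two states has an entry other than `0` and `1`. -/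
lemma Matrix.IsPrimitive.exists_entry_ne [Nontrivial S] {P : Matrix S S ℝ}
    (hP : P ∈ Matrix.rowStochastic ℝ S) (hprim : P.IsPrimitive) :
    ∃ i k, P i k ≠ 0 ∧ P i k ≠ 1 := by
  by_contra! hcon
  obtain ⟨h0, N, hN, hpos⟩ := hprim
  -- A `0`-`1` matrix has integer powers, so the positive entries of `P ^ N` are at least `1` and
  -- its row sums at least `2`, not `1`.
  let M : Matrix S S ℕ := Matrix.of fun i k => if P i k = 0 then 0 else 1
  have hM : P = M.map (Nat.castRingHom ℝ) := by
    ext i k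
    by_cases h : P i k = 0
    · simp [M, h]
    · simp [M, hcon i k h]
  have hge : ∀ i k, 1 ≤ (P ^ N) i k := by
    intro i k
    have := hpos i k
    rw [hM, ← Matrix.map_pow, Matrix.map_apply] at this ⊢
    simp only [Nat.coe_castRingHom] at this ⊢
    exact_mod_cast this
  obtain ⟨i, l, hil⟩ := exists_pair_ne S
  have hsum : ∑ k, (P ^ N) i k = 1 :=
    (Matrix.mem_rowStochastic_iff_sum.1 (pow_mem hP N)).2 i
  have : (2 : ℝ) ≤ ∑ k, (P ^ N) i k := by
    calc (2 : ℝ) ≤ Fintype.card S := by exact_mod_cast Fintype.one_lt_card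
      _ = ∑ k : S, (1 : ℝ) := by simp
      _ ≤ _ := Finset.sum_le_sum fun k _ => hge i k
  linarith

/-- The Perron eigenvalue of the entrywise power of a primitive stochastic matrix. -/
theorem exists_maxModulusEigenvalue_hadamardPow [Nontrivial S] {P : Matrix S S ℝ}
    (hP : P ∈ Matrix.rowStochastic ℝ S) (hprim : P.IsPrimitive) {j : ℕ} (hj : 2 ≤ j) :
    ∃ ρ : ℝ, IsMaxModulusEigenvalue (Matrix.of fun i k : S => ((P i k ^ j : ℝ) : ℂ)) (ρ : ℂ) ∧
      0 < ρ ∧ ρ < 1 ∧ ∃ v : S → ℝ, (∀ i, 0 < v i) ∧ (P.hadamardPow j).mulVec v = ρ • v := by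
  obtain ⟨ρ, hρ, u, v, hu, hv, hAu, hAv⟩ := (hprim.hadamardPow j).exists_pos_eigenvectors
  refine ⟨ρ, (hprim.hadamardPow j).isMaxModulusEigenvalue hρ hu hv hAu hAv, hρ, ?_, v, hv, hAv⟩
  have h0 := hprim.nonneg
  have hrow := (Matrix.mem_rowStochastic_iff_sum.1 hP).2
  have hle1 : ∀ i k, P i k ≤ 1 := fun i k =>
    hrow i ▸ Finset.single_le_sum (fun l _ => h0 i l) (Finset.mem_univ k)
  have hjle : ∀ i k, P i k ^ j ≤ P i k := fun i k =>
    pow_le_of_le_one (h0 i k) (hle1 i k) (by omega)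
  obtain ⟨i₀, k₀, hne0, hne1⟩ := hprim.exists_entry_ne hP
  have hlt : P i₀ k₀ ^ j < P i₀ k₀ :=
    pow_lt_self_of_lt_one₀ ((h0 _ _).lt_of_ne' hne0) ((hle1 _ _).lt_of_ne hne1) (by omega)
  -- Pairing the left eigenvector with the constant vector makes `ρ` a weighted mean of row sums,
  -- all at most `1` and one strictly less.
  have h1 : ∑ i, u i * ∑ k, P i k ^ j = ρ * ∑ i, u i := by
    have := Matrix.dotProduct_mulVec u (P.hadamardPow j) (fun _ => 1)
    rw [hAu, smul_dotProduct] at this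
    simpa [dotProduct, Matrix.mulVec] using this
  have hrowle : ∀ i, ∑ k, P i k ^ j ≤ 1 := fun i =>
    hrow i ▸ Finset.sum_le_sum fun k _ => hjle i k
  have h2 : ∑ i, u i * ∑ k, P i k ^ j < ∑ i, u i := by
    refine Finset.sum_lt_sum (fun i _ => mul_le_of_le_one_right (hu i).le (hrowle i))
      ⟨i₀, Finset.mem_univ _, mul_lt_of_lt_one_right (hu i₀) ?_⟩
    rw [← hrow i₀]
    exact Finset.sum_lt_sum (fun k _ => hjle i₀ k) ⟨k₀, Finset.mem_univ _, hlt⟩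
  have h3 : 0 < ∑ i, u i := Finset.sum_pos (fun i _ => hu i) Finset.univ_nonempty
  rw [h1] at h2
  exact (mul_lt_iff_lt_one_left h3).1 h2

end HadamardPower

/-! ### Word probabilities and collision sums. -/

section WordProbability

variable {S : Type*} [Fintype S]

/-- The probability that a chain with initial law `ν` and transition matrix `P` starts with the
word `w`. -/
def wordProb (ν : S → ℝ) (P : Matrix S S ℝ) : (n : ℕ) → (Fin n → S) → ℝ
  | 0, _ => 1
  | n + 1, w => ν (w 0) * ∏ t : Fin n, P (w t.castSucc) (w t.succ)

omit [Fintype S] in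
lemma wordProb_snoc (ν : S → ℝ) (P : Matrix S S ℝ) (n : ℕ) (w : Fin (n + 1) → S) (s : S) :
    wordProb ν P (n + 2) (Fin.snoc w s : Fin (n + 2) → S) =
      wordProb ν P (n + 1) w * P (w (Fin.last n)) s := by
  simp only [wordProb, Fin.prod_univ_castSucc (n := n)]
  have h0 : (Fin.snoc w s : Fin (n + 2) → S) 0 = w 0 := by
    rw [← Fin.castSucc_zero, Fin.snoc_castSucc]
  have h1 : ∀ t : Fin n, (Fin.snoc w s : Fin (n + 2) → S) t.castSucc.succ = w t.succ := by
    intro t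
    rw [← Fin.castSucc_succ, Fin.snoc_castSucc]
  simp only [h0, h1, Fin.snoc_castSucc, Fin.succ_last, Fin.snoc_last]
  ring

omit [Fintype S] in
lemma wordProb_nonneg {ν : S → ℝ} {P : Matrix S S ℝ} (hν : ∀ s, 0 ≤ ν s)
    (hP : ∀ i k, 0 ≤ P i k) (n : ℕ) (w : Fin n → S) : 0 ≤ wordProb ν P n w := by
  cases n with
  | zero => exact zero_le_one
  | succ n => exact mul_nonneg (hν _) (Finset.prod_nonneg fun _ _ => hP _ _)

/-- Summing out the last letter applies the entrywise power to `v`, which contributes exactly one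
factor `ρ`. -/
lemma sum_wordProb_pow_mul_eigenvector [DecidableEq S] {ν : S → ℝ} {P : Matrix S S ℝ} {j : ℕ}
    {ρ : ℝ} {v : S → ℝ} (hv : (P.hadamardPow j).mulVec v = ρ • v) (n : ℕ) :
    ∑ w : Fin (n + 1) → S, wordProb ν P (n + 1) w ^ j * v (w (Fin.last n)) =
      (∑ s, ν s ^ j * v s) * ρ ^ n := by
  induction n with
  | zero =>
    rw [pow_zero, mul_one, ← (Equiv.funUnique (Fin 1) S).sum_comp]
    simp [wordProb]
  | succ n ih =>
    rw [← (Fin.snocEquiv fun _ => S).sum_comp, Fintype.sum_prod_type_right, pow_succ, ← mul_assoc,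
      ← ih, Finset.sum_mul]
    refine Finset.sum_congr rfl fun w _ => ?_
    have h := congrFun hv (w (Fin.last n))
    simp only [Matrix.mulVec, dotProduct, Matrix.hadamardPow_apply, Pi.smul_apply,
      smul_eq_mul] at h
    rw [mul_assoc, mul_comm _ ρ, ← h, Finset.mul_sum]
    refine Finset.sum_congr rfl fun s _ => ?_
    have e : (Fin.snocEquiv fun _ => S) (s, w) = (Fin.snoc w s : Fin (n + 2) → S) := rfl
    rw [e, wordProb_snoc, mul_pow, Fin.snoc_last, mul_assoc]

/-- The sum of the `j`-th powers of the word probabilities grows like the powers of the Perron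
eigenvalue. -/
theorem sum_wordProb_pow_bounds [DecidableEq S] [Nonempty S] {ν : S → ℝ} {P : Matrix S S ℝ}
    (hν : ν ∈ stdSimplex ℝ S) (hP : ∀ i k, 0 ≤ P i k) {j : ℕ} {ρ : ℝ} (hρ : 0 < ρ) {v : S → ℝ}
    (hvpos : ∀ i, 0 < v i) (hv : (P.hadamardPow j).mulVec v = ρ • v) :
    ∃ c C : ℝ, 0 < c ∧ 0 < C ∧ ∀ n, c * ρ ^ n ≤ ∑ w, wordProb ν P n w ^ j ∧
      ∑ w, wordProb ν P n w ^ j ≤ C * ρ ^ n := by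
  obtain ⟨a, ha⟩ := Finite.exists_min v
  obtain ⟨b, hb⟩ := Finite.exists_max v
  set K := ∑ s, ν s ^ j * v s with hK
  have hKpos : 0 < K := by
    obtain ⟨s, -, hs⟩ : ∃ s ∈ Finset.univ, 0 < ν s := by
      by_contra! h
      have := Finset.sum_nonpos h
      rw [hν.2] at this
      linarith
    exact (Finset.sum_pos_iff_of_nonneg fun s _ =>
      mul_nonneg (pow_nonneg (hν.1 s) j) (hvpos s).le).2
      ⟨s, Finset.mem_univ s, mul_pos (pow_pos hs j) (hvpos s)⟩
  have hsucc : ∀ n, v a * ∑ w, wordProb ν P (n + 1) w ^ j ≤ K * ρ ^ n ∧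
      K * ρ ^ n ≤ v b * ∑ w, wordProb ν P (n + 1) w ^ j := by
    intro n
    have hnn : ∀ w, 0 ≤ wordProb ν P (n + 1) w ^ j := fun w =>
      pow_nonneg (wordProb_nonneg hν.1 hP _ w) j
    rw [hK, ← sum_wordProb_pow_mul_eigenvector hv n, Finset.mul_sum, Finset.mul_sum]
    constructor <;> refine Finset.sum_le_sum fun w _ => ?_
    · rw [mul_comm]
      exact mul_le_mul_of_nonneg_left (ha _) (hnn w)
    · rw [mul_comm (v b)]
      exact mul_le_mul_of_nonneg_left (hb _) (hnn w)
  -- The `1` covers the empty word; the division by `ρ` appears because `n + 1` letters involve only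
  -- `n` transitions.
  refine ⟨min 1 (K / (v b * ρ)), max 1 (K / (v a * ρ)),
    lt_min one_pos (div_pos hKpos (mul_pos (hvpos b) hρ)), lt_max_of_lt_left one_pos, ?_⟩
  intro n
  cases n with
  | zero => simp [wordProb]
  | succ n =>
    obtain ⟨h1, h2⟩ := hsucc n
    constructor
    · refine (mul_le_mul_of_nonneg_right (min_le_right _ _) (by positivity)).trans ?_
      rw [pow_succ, div_mul_eq_mul_div, div_le_iff₀ (mul_pos (hvpos b) hρ)]
      nlinarith
    · refine le_trans ?_ (mul_le_mul_of_nonneg_right (le_max_right _ _) (by positivity))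
      rw [pow_succ, div_mul_eq_mul_div, le_div_iff₀ (mul_pos (hvpos a) hρ)]
      nlinarith

omit [Fintype S] in
/-- The law of the prefixes of a Markov chain. -/
lemma IsMarkovChain.measureReal_prefix {Ω : Type*} [MeasurableSpace Ω] [MeasurableSpace S]
    {μ : Measure Ω} [IsProbabilityMeasure μ] {ν : S → ℝ} {P : Matrix S S ℝ} {X : ℕ → Ω → S}
    (hX : IsMarkovChain μ ν P X) (hν : ∀ s, 0 ≤ ν s) (hP : ∀ i k, 0 ≤ P i k) (n : ℕ)
    (u : Fin n → S) : μ.real {ω | (fun t : Fin n => X t ω) = u} = wordProb ν P n u := by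
  cases n with
  | zero => simp [wordProb, Subsingleton.elim _ u]
  | succ n =>
    let w : ℕ → S := fun t => u (Fin.ofNat (n + 1) t)
    have hw : ∀ t : Fin (n + 1), w t = u t := fun t => by simp [w]
    have hset : {ω | (fun t : Fin (n + 1) => X t ω) = u} = {ω | ∀ t ≤ n, X t ω = w t} := by
      ext ω
      simp only [Set.mem_ofPred_eq, funext_iff]
      constructor
      · intro h t ht
        simpa [w, Nat.mod_eq_of_lt (Nat.lt_succ_of_le ht)] using h (Fin.ofNat (n + 1) t)
      · intro h t
        rw [h t (Nat.le_of_lt_succ t.2), hw]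
    have hval : ν (w 0) * ∏ t ∈ Finset.range n, P (w t) (w (t + 1)) = wordProb ν P (n + 1) u := by
      rw [Finset.prod_range, wordProb]
      congr 1
      exact Finset.prod_congr rfl fun t _ => by
        rw [← hw, ← hw]; simp
    rw [Measure.real, hset, hX.path_law n w, hval,
      ENNReal.toReal_ofReal (wordProb_nonneg hν hP _ u)]

end WordProbability

/-! ### Second moment method for values common to independent groups. -/

section SecondMoment

/-- If random variables indexed by pairs are independent, then so are the families obtained by
grouping them along the first index. -/
lemma ProbabilityTheory.iIndepFun.curry {Ω ι κ : Type*} [MeasurableSpace Ω] {μ : Measure Ω}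
    {α : Type*} [MeasurableSpace α] {W : ι × κ → Ω → α}
    (hW : ∀ x, Measurable (W x)) (h : iIndepFun W μ) :
    iIndepFun (fun (g : ι) (ω : Ω) (i : κ) => W (g, i) ω) μ := by
  have := h.isProbabilityMeasure
  have : ∀ x, IsProbabilityMeasure (μ.map (W x)) :=
    fun x => Measure.isProbabilityMeasure_map (hW x).aemeasurable
  rw [iIndepFun_iff_map_fun_eq_infinitePi_map (by fun_prop)]
  have h1 := (iIndepFun_iff_map_fun_eq_infinitePi_map hW).1 h
  have h2 : ∀ g, μ.map (fun ω i => W (g, i) ω) =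
      Measure.infinitePi fun i => μ.map (W (g, i)) := fun g =>
    (iIndepFun_iff_map_fun_eq_infinitePi_map fun i => hW (g, i)).1
      (h.precomp (g := fun i => (g, i)) (Prod.mk_right_injective g))
  have h3 := Measure.infinitePi_map_curry (fun (g : ι) (i : κ) => μ.map (W (g, i)))
  simp_rw [h2]
  rw [← h3]
  have h1' : μ.map (fun ω x => W x ω) = Measure.infinitePi fun x : ι × κ => μ.map (W (x.1, x.2)) :=
    h1
  rw [← h1', Measure.map_map (by fun_prop) (by fun_prop)]
  rfl

lemma MeasureTheory.integrable_comp_of_finite {Ω β : Type*} [MeasurableSpace Ω] {μ : Measure Ω}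
    [IsFiniteMeasure μ] [Finite β] [MeasurableSpace β] [MeasurableSingletonClass β]
    {W : Ω → β} (hW : Measurable W) (F : β → ℝ) : Integrable (fun ω => F (W ω)) μ :=
  (Integrable.of_finite : Integrable F (μ.map W)).comp_measurable hW

/-- Controls the diagonal excess in the variance below: the constant dominates for `x ≤ 1`, the
power `x ^ n` for `x ≥ 1`. -/
lemma add_one_pow_sub_pow_le {x : ℝ} (hx : 0 ≤ x) (n : ℕ) :
    (x + 1) ^ (n + 1) - x ^ (n + 1) ≤ 2 ^ (n + 1) * (1 + x ^ n) := by
  rcases le_total x 1 with h | h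
  · have h1 : (x + 1) ^ (n + 1) ≤ 2 ^ (n + 1) := pow_le_pow_left₀ (by linarith) (by linarith) _
    have h2 : 0 ≤ x ^ (n + 1) := by positivity
    have h3 : 0 ≤ (2 : ℝ) ^ (n + 1) * x ^ n := by positivity
    linarith
  · have key : (x + 1) ^ (n + 1) - x ^ (n + 1) ≤ (2 ^ (n + 1) - 1) * x ^ n := by
      induction n with
      | zero => norm_num
      | succ n ih =>
        have h1 : (1 : ℝ) ≤ 2 ^ (n + 1) := one_le_pow₀ one_le_two
        calc (x + 1) ^ (n + 1 + 1) - x ^ (n + 1 + 1)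
            = (x + 1) * ((x + 1) ^ (n + 1) - x ^ (n + 1)) + x ^ (n + 1) := by ring
          _ ≤ (2 * x) * ((2 ^ (n + 1) - 1) * x ^ n) + x ^ (n + 1) := by
            have : 0 ≤ (2 ^ (n + 1) - 1) * x ^ n := mul_nonneg (by linarith) (by positivity)
            have h3 : (x + 1) * ((x + 1) ^ (n + 1) - x ^ (n + 1)) ≤
                (x + 1) * ((2 ^ (n + 1) - 1) * x ^ n) :=
              mul_le_mul_of_nonneg_left ih (by linarith)
            nlinarith
          _ = (2 ^ (n + 1 + 1) - 1) * x ^ (n + 1) := by ring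
    have : 0 ≤ x ^ n := by positivity
    have h2 : (0 : ℝ) ≤ 2 ^ (n + 1) := by positivity
    nlinarith

variable {Ω ι κ α : Type*} [MeasurableSpace Ω] {μ : Measure Ω} [IsProbabilityMeasure μ]
  [Fintype ι] [Fintype κ] [Fintype α] [DecidableEq α]
  [MeasurableSpace α] [MeasurableSingletonClass α]

/-- The number of indices at which a family takes the value `a`. -/
def occCount {κ α : Type*} [Fintype κ] [DecidableEq α] (y : κ → α) (a : α) : ℝ :=
  ∑ i, if y i = a then 1 else 0

omit [IsProbabilityMeasure μ] [Fintype α] in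
lemma integral_ite_eq [IsFiniteMeasure μ] {V : Ω → α} (hV : Measurable V) (a : α) :
    ∫ ω, (if V ω = a then (1 : ℝ) else 0) ∂μ = μ.real {ω | V ω = a} := by
  have hm : MeasurableSet {ω | V ω = a} := hV (measurableSet_singleton a)
  rw [← integral_indicator_one hm]
  exact integral_congr_ae (.of_forall fun ω => by simp [Set.indicator])

lemma integral_occCount {V : κ → Ω → α} (hV : ∀ i, Measurable (V i)) {p : α → ℝ}
    (hp : ∀ i a, μ.real {ω | V i ω = a} = p a) (a : α) :
    ∫ ω, occCount (fun i => V i ω) a ∂μ = Fintype.card κ * p a := by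
  simp only [occCount]
  rw [integral_finsetSum _ fun i _ =>
    integrable_comp_of_finite (hV i) fun s => if s = a then (1 : ℝ) else 0]
  simp [integral_ite_eq (hV _), hp]

/-- Expand into pairs of indices: distinct indices factor by independence, and equal indices
contribute only when `a = a'`. -/
lemma integral_occCount_mul_le {V : κ → Ω → α} (hV : ∀ i, Measurable (V i))
    (hind : iIndepFun V μ) {p : α → ℝ} (hp : ∀ i a, μ.real {ω | V i ω = a} = p a) (a a' : α) :
    ∫ ω, occCount (fun i => V i ω) a * occCount (fun i => V i ω) a' ∂μ ≤
      (Fintype.card κ * p a) * (Fintype.card κ * p a') +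
        if a = a' then Fintype.card κ * p a else 0 := by
  classical
  have hterm : ∀ i i', ∫ ω, (if V i ω = a then (1 : ℝ) else 0) * (if V i' ω = a' then 1 else 0) ∂μ
      ≤ p a * p a' + if i = i' then (if a = a' then p a else 0) else 0 := by
    intro i i'
    rcases eq_or_ne i i' with rfl | hne
    · have hpp : 0 ≤ p a * p a' := by
        rw [← hp i a, ← hp i a']; positivity
      rw [if_pos rfl]
      by_cases haa : a = a'
      · subst haa
        simp only [mul_ite, mul_one, mul_zero, if_true]
        have : ∀ ω, (if V i ω = a then (if V i ω = a then (1 : ℝ) else 0) else 0) =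
            if V i ω = a then 1 else 0 := fun ω => by split_ifs <;> rfl
        simp only [this]
        rw [integral_ite_eq (hV i), hp]
        linarith
      · have : ∀ ω, (if V i ω = a then (1 : ℝ) else 0) * (if V i ω = a' then 1 else 0) = 0 := by
          intro ω
          by_cases h : V i ω = a
          · simp [h, haa]
          · simp [h]
        simp only [this, integral_zero, haa, if_false, add_zero]
        exact hpp
    · rw [if_neg hne, add_zero]
      have hI := (hind.indepFun hne).comp
        (φ := fun s => if s = a then (1 : ℝ) else 0) (ψ := fun s => if s = a' then (1 : ℝ) else 0)
        (measurable_of_finite _) (measurable_of_finite _)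
      have := hI.integral_fun_mul_eq_mul_integral
        (integrable_comp_of_finite (hV i) fun s => if s = a then (1 : ℝ) else 0).aestronglyMeasurable
        (integrable_comp_of_finite (hV i') fun s =>
          if s = a' then (1 : ℝ) else 0).aestronglyMeasurable
      simp only [Function.comp_apply] at this
      rw [this, integral_ite_eq (hV i), integral_ite_eq (hV i'), hp, hp]
  simp only [occCount, Finset.sum_mul_sum]
  have hVm : Measurable fun ω i => V i ω := measurable_pi_lambda _ hV
  rw [integral_finsetSum _ fun i _ => integrable_comp_of_finite hVm fun y : κ → α =>
    ∑ i', (if y i = a then (1 : ℝ) else 0) * (if y i' = a' then 1 else 0)]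
  calc ∑ i, ∫ ω, ∑ i', (if V i ω = a then (1 : ℝ) else 0) * (if V i' ω = a' then 1 else 0) ∂μ
      = ∑ i, ∑ i', ∫ ω, (if V i ω = a then (1 : ℝ) else 0) * (if V i' ω = a' then 1 else 0) ∂μ :=
        Finset.sum_congr rfl fun i _ => integral_finsetSum _ fun i' _ =>
          integrable_comp_of_finite hVm fun y : κ → α =>
            (if y i = a then (1 : ℝ) else 0) * (if y i' = a' then 1 else 0)
    _ ≤ ∑ i : κ, ∑ i' : κ, (p a * p a' + if i = i' then (if a = a' then p a else 0) else 0) :=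
        Finset.sum_le_sum fun i _ => Finset.sum_le_sum fun i' _ => hterm i i'
    _ = _ := by
        simp only [Finset.sum_add_distrib, Finset.sum_const, Finset.card_univ, nsmul_eq_mul,
          Finset.sum_ite_eq, Finset.mem_univ, if_true, mul_ite, mul_zero]
        congr 1
        ring

/-- Second moment bound: if `card ι` groups of `card κ` independent samples from `p` are drawn, then
some value is hit by every group with high probability. -/
theorem measureReal_no_common_value_le [Nonempty ι] {W : ι × κ → Ω → α}
    (hW : ∀ x, Measurable (W x)) (hind : iIndepFun W μ) {p : α → ℝ}
    (hp : ∀ x a, μ.real {ω | W x ω = a} = p a) (hp0 : ∀ a, 0 ≤ p a) {L : ℝ} (hL : 0 < L)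
    (hLp : L ^ Fintype.card ι ≤ ∑ a, (Fintype.card κ * p a) ^ Fintype.card ι) :
    μ.real {ω | ∀ a, ∃ g, ∀ i, W (g, i) ω ≠ a} ≤ 2 ^ (Fintype.card ι + 1) / L := by
  obtain ⟨n, hn⟩ : ∃ n, Fintype.card ι = n + 1 :=
    ⟨Fintype.card ι - 1, (Nat.succ_pred_eq_of_pos Fintype.card_pos).symm⟩
  set x : α → ℝ := fun a => Fintype.card κ * p a with hx
  have hx0 : ∀ a, 0 ≤ x a := fun a => mul_nonneg (Nat.cast_nonneg _) (hp0 a)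
  set E := ∑ a, x a ^ (n + 1) with hE
  rw [hn] at hLp ⊢
  change L ^ (n + 1) ≤ E at hLp
  have hEpos : 0 < E := (pow_pos hL _).trans_le hLp
  -- The root `y` of the mean is the natural scale: it dominates `L` and every `x a`, and the bound
  -- is trivial when `y < 1`.
  obtain ⟨y, hy0, hyE⟩ : ∃ y : ℝ, 0 ≤ y ∧ y ^ (n + 1) = E :=
    ⟨E ^ ((1 : ℝ) / (n + 1 : ℕ)), by positivity, by
      rw [← Real.rpow_natCast, ← Real.rpow_mul hEpos.le, one_div_mul_cancel (by positivity),
        Real.rpow_one]⟩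
  have hLy : L ≤ y := le_of_pow_le_pow_left₀ (Nat.succ_ne_zero n) hy0 (hyE ▸ hLp)
  have hypos : 0 < y := hL.trans_le hLy
  refine le_trans ?_ (div_le_div_of_nonneg_left (by positivity) hL hLy)
  rcases lt_or_ge y 1 with hy1 | hy1
  · refine measureReal_le_one.trans ?_
    rw [one_le_div hypos]
    exact hy1.le.trans (one_le_pow₀ one_le_two)
  -- Counts the choices of one index per group that agree on a value. The product over groups lets
  -- expectations factor.
  set F : (ι → κ → α) → ℝ := fun w => ∑ a, ∏ g, occCount (w g) a with hF
  set U : Ω → ℝ := fun ω => F fun g i => W (g, i) ω with hU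
  have hWm : Measurable fun ω g i => W (g, i) ω :=
    measurable_pi_lambda _ fun g => measurable_pi_lambda _ fun i => hW (g, i)
  have hint : ∀ G : (ι → κ → α) → ℝ, Integrable (fun ω => G fun g i => W (g, i) ω) μ :=
    fun G => integrable_comp_of_finite hWm G
  have hUm : MemLp U 2 μ :=
    (memLp_two_iff_integrable_sq (hint F).aestronglyMeasurable).2 (hint fun w => F w ^ 2)
  have hgroup := hind.curry hW
  have hEU : ∫ ω, U ω ∂μ = E := by
    simp only [hU, hF, hE]
    rw [integral_finsetSum _ fun a _ => hint fun w => ∏ g, occCount (w g) a]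
    refine Finset.sum_congr rfl fun a _ => ?_
    have h1 := (hgroup.comp (fun _ y => occCount y a)
      fun _ => measurable_of_finite _).integral_fun_prod_eq_prod_integral
      fun g => (hint fun w => occCount (w g) a).aestronglyMeasurable
    simp only [Function.comp_apply] at h1
    rw [h1, Finset.prod_congr rfl fun g _ =>
      integral_occCount (fun i => hW (g, i)) (fun i => hp (g, i)) a, Finset.prod_const,
      Finset.card_univ, hn]
  have hEU2 : ∫ ω, U ω ^ 2 ∂μ ≤ E ^ 2 + ∑ a, (x a * x a + x a) ^ (n + 1) -
      ∑ a, (x a * x a) ^ (n + 1) := by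
    have hexp : ∀ ω, U ω ^ 2 = ∑ a, ∑ a', ∏ g,
        occCount (fun i => W (g, i) ω) a * occCount (fun i => W (g, i) ω) a' := fun ω => by
      simp only [hU, hF, sq, Finset.sum_mul_sum, Finset.prod_mul_distrib]
    simp only [hexp]
    rw [integral_finsetSum _ fun a _ => hint fun w =>
      ∑ a', ∏ g, occCount (w g) a * occCount (w g) a']
    have hle : ∀ a a', ∫ ω, ∏ g, occCount (fun i => W (g, i) ω) a *
        occCount (fun i => W (g, i) ω) a' ∂μ ≤ x a ^ (n + 1) * x a' ^ (n + 1) +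
          if a = a' then (x a * x a + x a) ^ (n + 1) - (x a * x a) ^ (n + 1) else 0 := by
      intro a a'
      have h1 := (hgroup.comp (fun _ y => occCount y a * occCount y a')
        fun _ => measurable_of_finite _).integral_fun_prod_eq_prod_integral
        fun g => (hint fun w => occCount (w g) a * occCount (w g) a').aestronglyMeasurable
      simp only [Function.comp_apply] at h1
      rw [h1]
      calc _ ≤ ∏ _g : ι, (x a * x a' + if a = a' then x a else 0) := by
            refine Finset.prod_le_prod (fun g _ => integral_nonneg fun ω => ?_) fun g _ =>
              integral_occCount_mul_le (fun i => hW (g, i))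
                (hind.precomp (g := fun i => (g, i)) (Prod.mk_right_injective g))
                (fun i => hp (g, i)) a a'
            exact mul_nonneg (Finset.sum_nonneg fun _ _ => by split_ifs <;> norm_num)
              (Finset.sum_nonneg fun _ _ => by split_ifs <;> norm_num)
        _ = _ := by
            rw [Finset.prod_const, Finset.card_univ, hn]
            by_cases h : a = a'
            · subst h
              simp only [if_true]
              rw [mul_pow (x a) (x a)]; ring
            · simp [h, mul_pow]
    calc _ ≤ ∑ a, ∑ a', (x a ^ (n + 1) * x a' ^ (n + 1) +
          if a = a' then (x a * x a + x a) ^ (n + 1) - (x a * x a) ^ (n + 1) else 0) := by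
          refine Finset.sum_le_sum fun a _ => ?_
          rw [integral_finsetSum _ fun a' _ => hint fun w =>
            ∏ g, occCount (w g) a * occCount (w g) a']
          exact Finset.sum_le_sum fun a' _ => hle a a'
      _ = _ := by
          simp only [Finset.sum_add_distrib, Finset.sum_ite_eq, Finset.mem_univ, if_true,
            Finset.sum_sub_distrib]
          rw [← Finset.sum_mul_sum, sq, ← hE]
          ring
  -- Only the diagonal `a = a'` exceeds the squared mean. Since `E = y ^ (n + 1)`, dividing by `E ^
  -- 2` leaves a multiple of `1 / y`.
  have hVar : Var[U; μ] ≤ 2 ^ (n + 2) * (E * y ^ n) := by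
    rw [variance_eq_sub hUm]
    have h1 : ∀ a, (x a * x a + x a) ^ (n + 1) - (x a * x a) ^ (n + 1) ≤
        2 ^ (n + 2) * (x a ^ (n + 1) * y ^ n) := by
      intro a
      have hxy : x a ≤ y := le_of_pow_le_pow_left₀ (Nat.succ_ne_zero n) hy0 (hyE ▸
        Finset.single_le_sum (f := fun a => x a ^ (n + 1))
          (fun a _ => pow_nonneg (hx0 a) _) (Finset.mem_univ a))
      have h2 : x a ^ n ≤ y ^ n := pow_le_pow_left₀ (hx0 a) hxy n
      have h3 : 1 ≤ y ^ n := one_le_pow₀ hy1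
      calc (x a * x a + x a) ^ (n + 1) - (x a * x a) ^ (n + 1)
          = x a ^ (n + 1) * ((x a + 1) ^ (n + 1) - x a ^ (n + 1)) := by
            rw [show x a * x a + x a = x a * (x a + 1) by ring, mul_pow, mul_pow]; ring
        _ ≤ x a ^ (n + 1) * (2 ^ (n + 1) * (y ^ n + y ^ n)) := by
            refine mul_le_mul_of_nonneg_left ((add_one_pow_sub_pow_le (hx0 a) n).trans ?_)
              (pow_nonneg (hx0 a) _)
            exact mul_le_mul_of_nonneg_left (by linarith) (by positivity)
        _ = _ := by ring
    have h4 := Finset.sum_le_sum fun a (_ : a ∈ Finset.univ) => h1 a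
    rw [Finset.sum_sub_distrib, ← Finset.mul_sum, ← Finset.sum_mul, ← hE] at h4
    have h5 : ∫ ω, (U ^ 2) ω ∂μ = ∫ ω, U ω ^ 2 ∂μ := rfl
    rw [h5, hEU]
    linarith
  have hsub : {ω | ∀ a, ∃ g, ∀ i, W (g, i) ω ≠ a} ⊆ {ω | E ≤ |U ω - ∫ ω, U ω ∂μ|} := by
    intro ω hω
    have : U ω = 0 := by
      refine Finset.sum_eq_zero fun a _ => ?_
      obtain ⟨g, hg⟩ := hω a
      exact Finset.prod_eq_zero (Finset.mem_univ g)
        (Finset.sum_eq_zero fun i _ => if_neg (hg i))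
    simp only [Set.mem_ofPred_eq, this, hEU, zero_sub, abs_neg]
    exact le_abs_self E
  have hcheb := (measure_mono hsub).trans (meas_ge_le_variance_div_sq hUm hEpos)
  refine (ENNReal.toReal_le_of_le_ofReal (div_nonneg (variance_nonneg _ _) (sq_nonneg _))
    hcheb).trans ?_
  rw [div_le_div_iff₀ (by positivity) hypos]
  calc Var[U; μ] * y ≤ 2 ^ (n + 2) * (E * y ^ n) * y := mul_le_mul_of_nonneg_right hVar hy0
    _ = 2 ^ (n + 2) * (E * y ^ (n + 1)) := by ring
    _ = 2 ^ (n + 1 + 1) * E ^ 2 := by rw [hyE]; ring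

end SecondMoment

/-! ### Moment bounds for the occupancy of boxes. -/

section Trie

variable {Ω S : Type*} [DecidableEq S]

lemma AllBoxesLt.mono_generation {X : ℕ → ℕ → Ω → S} {m j n n' : ℕ} {ω : Ω} (hn : n ≤ n')
    (h : AllBoxesLt X m j n ω) : AllBoxesLt X m j n' ω := by
  intro u
  refine (Finset.card_le_card fun k hk => ?_).trans_lt (h fun t => u (Fin.castLE hn t))
  rw [Finset.mem_filter] at hk ⊢
  exact ⟨hk.1, fun t => hk.2 (Fin.castLE hn t)⟩

lemma AllBoxesLt.anti_balls {X : ℕ → ℕ → Ω → S} {m m' j n : ℕ} {ω : Ω} (hm : m ≤ m')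
    (h : AllBoxesLt X m' j n ω) : AllBoxesLt X m j n ω := fun u =>
  (Finset.card_le_card (Finset.filter_subset_filter _ (Finset.range_mono hm))).trans_lt (h u)

lemma AllBoxesLt.trieHeight_le {X : ℕ → ℕ → Ω → S} {m j n : ℕ} {ω : Ω}
    (h : AllBoxesLt X m j n ω) : trieHeight X m j ω ≤ n := Nat.sInf_le h

/-- `hex` is needed because `sInf ∅ = 0`; the upper bound `AllBoxesLt.trieHeight_le` needs no such
assumption. -/
lemma lt_trieHeight {X : ℕ → ℕ → Ω → S} {m j n : ℕ} {ω : Ω}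
    (hex : ∃ n, AllBoxesLt X m j n ω) (h : ¬ AllBoxesLt X m j n ω) : n < trieHeight X m j ω := by
  by_contra! hle
  exact h (AllBoxesLt.mono_generation hle (Nat.sInf_mem hex))

variable [MeasurableSpace Ω] {μ : Measure Ω} [IsProbabilityMeasure μ] [Fintype S]
  [MeasurableSpace S] [MeasurableSingletonClass S]

omit [DecidableEq S] [Fintype S] [MeasurableSingletonClass S] [IsProbabilityMeasure μ] in
lemma iIndepFun_prefix {X : ℕ → ℕ → Ω → S}
    (hindep : iIndepFun (fun (k : ℕ) (ω : Ω) (t : ℕ) => X k t ω) μ) (n : ℕ) :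
    iIndepFun (fun (k : ℕ) (ω : Ω) (t : Fin n) => X k t ω) μ :=
  hindep.comp (fun _ (y : ℕ → S) (t : Fin n) => y t) fun _ =>
    measurable_pi_lambda _ fun _ => measurable_pi_apply _

/-- First moment bound for the occurrence of a box with at least `j` balls. -/
theorem measureReal_not_allBoxesLt_le {X : ℕ → ℕ → Ω → S}
    (hindep : iIndepFun (fun (k : ℕ) (ω : Ω) (t : ℕ) => X k t ω) μ) {n : ℕ}
    {p : (Fin n → S) → ℝ} (hp : ∀ k u, μ.real {ω | (fun t : Fin n => X k t ω) = u} = p u)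
    (m j : ℕ) :
    μ.real {ω | ¬ AllBoxesLt X m j n ω} ≤ (m : ℝ) ^ j * ∑ u, p u ^ j := by
  -- Union bound over words and over `j`-subsets of balls.
  have hsub : {ω | ¬ AllBoxesLt X m j n ω} ⊆ ⋃ u ∈ (Finset.univ : Finset (Fin n → S)),
      ⋃ T ∈ (Finset.range m).powersetCard j,
        ⋂ k ∈ T, (fun ω (t : Fin n) => X k t ω) ⁻¹' {u} := by
    intro ω hω
    simp only [AllBoxesLt, not_forall, not_lt, Set.mem_ofPred_eq] at hω
    obtain ⟨u, hu⟩ := hω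
    obtain ⟨T, hT, hTc⟩ := Finset.exists_subset_card_eq hu
    simp only [Set.mem_iUnion, Set.mem_iInter]
    refine ⟨u, Finset.mem_univ u, T, Finset.mem_powersetCard.2
      ⟨hT.trans (Finset.filter_subset _ _), hTc⟩, fun k hk => ?_⟩
    exact funext (Finset.mem_filter.1 (hT hk)).2
  have hT : ∀ u, ∀ T ∈ (Finset.range m).powersetCard j,
      μ.real (⋂ k ∈ T, (fun ω (t : Fin n) => X k t ω) ⁻¹' {u}) = p u ^ j := by
    intro u T hT
    rw [Measure.real, (iIndepFun_prefix hindep n).measure_inter_preimage_eq_mul T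
      (fun k _ => measurableSet_singleton u), ENNReal.toReal_prod]
    rw [← (Finset.mem_powersetCard.1 hT).2]
    exact Finset.prod_eq_pow_card fun k _ => hp k u
  have hp0 : ∀ u, 0 ≤ p u := fun u => hp 0 u ▸ measureReal_nonneg
  calc μ.real {ω | ¬ AllBoxesLt X m j n ω}
      ≤ ∑ u, ∑ T ∈ (Finset.range m).powersetCard j,
          μ.real (⋂ k ∈ T, (fun ω (t : Fin n) => X k t ω) ⁻¹' {u}) :=
        (measureReal_mono hsub (measure_ne_top _ _)).trans ((measureReal_biUnion_finset_le _ _).trans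
          (Finset.sum_le_sum fun u _ => measureReal_biUnion_finset_le _ _))
    _ = ∑ u, (m.choose j : ℝ) * p u ^ j := Finset.sum_congr rfl fun u _ => by
        rw [Finset.sum_congr rfl (hT u), Finset.sum_const, Finset.card_powersetCard,
          Finset.card_range, nsmul_eq_mul]
    _ ≤ (m : ℝ) ^ j * ∑ u, p u ^ j := by
        rw [← Finset.mul_sum]
        refine mul_le_mul_of_nonneg_right ?_ (Finset.sum_nonneg fun u _ => pow_nonneg (hp0 u) j)
        exact_mod_cast Nat.choose_le_pow m j

/-- Second moment bound for the absence of boxes with at least `j` balls. -/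
theorem measureReal_allBoxesLt_le {X : ℕ → ℕ → Ω → S} (hX : ∀ k t, Measurable (X k t))
    (hindep : iIndepFun (fun (k : ℕ) (ω : Ω) (t : ℕ) => X k t ω) μ) {n : ℕ}
    {p : (Fin n → S) → ℝ} (hp : ∀ k u, μ.real {ω | (fun t : Fin n => X k t ω) = u} = p u)
    {j : ℕ} (hj : 0 < j) (b : ℕ) {L : ℝ} (hL : 0 < L) (hLp : L ^ j ≤ (b : ℝ) ^ j * ∑ u, p u ^ j) :
    μ.real {ω | AllBoxesLt X (j * b) j n ω} ≤ 2 ^ (j + 1) / L := by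
  have : Nonempty (Fin j) := ⟨⟨0, hj⟩⟩
  -- The `j * b` balls form `j` disjoint groups of `b`; a word hit by every group receives `j`
  -- distinct balls.
  have hinj : Function.Injective fun x : Fin j × Fin b => (finProdFinEquiv x : ℕ) :=
    Fin.val_injective.comp finProdFinEquiv.injective
  have h := measureReal_no_common_value_le (μ := μ) (ι := Fin j) (κ := Fin b)
    (W := fun x ω (t : Fin n) => X (finProdFinEquiv x : ℕ) t ω)
    (fun x => measurable_pi_lambda _ fun t => hX _ t)
    ((iIndepFun_prefix hindep n).precomp hinj) (fun x => hp _)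
    (fun u => hp 0 u ▸ measureReal_nonneg) hL (by
      simpa only [Fintype.card_fin, mul_pow, ← Finset.mul_sum] using hLp)
  rw [Fintype.card_fin] at h
  refine (measureReal_mono fun ω hω => ?_).trans h
  simp only [Set.mem_ofPred_eq] at hω ⊢
  by_contra! hcon
  obtain ⟨u, hu⟩ := hcon
  choose i hi using hu
  refine (hω u).not_ge ?_
  have hg : Function.Injective fun g : Fin j => (finProdFinEquiv (g, i g) : ℕ) := fun g g' hgg =>
    congrArg Prod.fst (hinj hgg)
  calc j = (Finset.univ.image fun g : Fin j => (finProdFinEquiv (g, i g) : ℕ)).card := by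
        rw [Finset.card_image_of_injective _ hg, Finset.card_univ, Fintype.card_fin]
    _ ≤ ballCount X (j * b) n u ω := Finset.card_le_card fun k hk => by
        obtain ⟨g, -, rfl⟩ := Finset.mem_image.1 hk
        exact Finset.mem_filter.2 ⟨Finset.mem_range.2 (finProdFinEquiv (g, i g)).2,
          fun t => congrFun (hi g) t⟩

end Trie

/-! ### Almost sure asymptotics by Borel–Cantelli. -/

section HeightAsymptotics

lemma tendsto_log_natCast_atTop : Tendsto (fun m : ℕ => Real.log m) atTop atTop :=
  Real.tendsto_log_atTop.comp tendsto_natCast_atTop_atTop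

variable {Ω S : Type*} [DecidableEq S] [MeasurableSpace Ω] {μ : Measure Ω}
  [IsProbabilityMeasure μ] {X : ℕ → ℕ → Ω → S} {j : ℕ} {ρ : ℝ}

omit [DecidableEq S] in
lemma ae_eventually_notMem_of_summable {s : ℕ → Set Ω} {f : ℕ → ℝ} (hf : Summable f)
    (h : ∀ k, μ.real (s k) ≤ f k) : ∀ᵐ ω ∂μ, ∀ᶠ k in atTop, ω ∉ s k := by
  refine ae_eventually_notMem (ne_top_of_le_ne_top hf.tsum_ofReal_ne_top
    (ENNReal.tsum_le_tsum fun k => ?_))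
  rw [← ofReal_measureReal]
  exact ENNReal.ofReal_le_ofReal (h k)

lemma Nat.tendsto_log_two_atTop : Tendsto (Nat.log 2) atTop atTop :=
  tendsto_atTop_atTop.2 fun b => ⟨2 ^ b, fun _ hm =>
    (Nat.log_pow one_lt_two b).symm.trans_le (Nat.log_mono_right hm)⟩

lemma ae_exists_allBoxesLt (hρ : 0 < ρ) (hρ1 : ρ < 1) {C : ℝ}
    (hup : ∀ m n : ℕ, μ.real {ω | ¬ AllBoxesLt X m j n ω} ≤ (m : ℝ) ^ j * (C * ρ ^ n)) :
    ∀ᵐ ω ∂μ, ∀ m : ℕ, ∃ n : ℕ, AllBoxesLt X m j n ω := by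
  rw [ae_all_iff]
  intro m
  have hlim : Tendsto (fun n : ℕ => (m : ℝ) ^ j * (C * ρ ^ n)) atTop (𝓝 0) := by
    simpa using ((tendsto_pow_atTop_nhds_zero_of_lt_one hρ.le hρ1).const_mul C).const_mul
      ((m : ℝ) ^ j)
  have h0 : μ.real {ω | ¬ ∃ n, AllBoxesLt X m j n ω} ≤ 0 :=
    ge_of_tendsto' hlim fun n => (measureReal_mono (by
      intro ω (hω : ¬ ∃ n, AllBoxesLt X m j n ω) hn
      exact hω ⟨n, hn⟩)).trans (hup m n)
  rw [ae_iff]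
  exact (measureReal_eq_zero_iff).1 (h0.antisymm measureReal_nonneg)

lemma pow_eq_exp_neg_log (hρ : 0 < ρ) (n : ℕ) : ρ ^ n = Real.exp (-(-Real.log ρ * n)) := by
  rw [neg_mul, neg_neg, mul_comm, Real.exp_nat_mul, Real.exp_log hρ]

lemma ae_eventually_trieHeight_le (hρ : 0 < ρ) (hρ1 : ρ < 1) {C : ℝ} (hC : 0 < C)
    (hup : ∀ m n : ℕ, μ.real {ω | ¬ AllBoxesLt X m j n ω} ≤ (m : ℝ) ^ j * (C * ρ ^ n)) :
    ∃ D : ℝ, ∀ᵐ ω ∂μ, ∀ᶠ m : ℕ in atTop, (trieHeight X m j ω : ℝ) / Real.log m ≤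
      (j : ℝ) / (-Real.log ρ) + D * (Real.log (Real.log m) / Real.log m) := by
  set l := -Real.log ρ with hl
  have hlpos : 0 < l := neg_pos.2 (Real.log_neg hρ hρ1)
  -- The threshold for `2 ^ (k + 1)` balls plus a slack that turns the first moment into the
  -- summable `C / (k + 1) ^ 2`.
  let N : ℕ → ℕ := fun k => ⌈(j * ((k + 1 : ℕ) * Real.log 2) + 2 * Real.log (k + 1 : ℕ)) / l⌉₊
  have hBC : ∀ᵐ ω ∂μ, ∀ᶠ k in atTop, ω ∉ {ω | ¬ AllBoxesLt X (2 ^ (k + 1)) j (N k) ω} := by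
    have hs : Summable fun k : ℕ => C * (1 / ((k + 1 : ℕ) : ℝ) ^ 2) :=
      ((summable_nat_add_iff 1).2 (Real.summable_one_div_nat_pow.2 one_lt_two)).mul_left C
    refine ae_eventually_notMem_of_summable hs fun k => (hup _ _).trans ?_
    have hk : (0 : ℝ) < (k + 1 : ℕ) := by positivity
    have h1 : ρ ^ N k ≤ Real.exp (-(j * ((k + 1 : ℕ) * Real.log 2) +
        2 * Real.log (k + 1 : ℕ))) := by
      rw [pow_eq_exp_neg_log hρ, ← hl, Real.exp_le_exp, neg_le_neg_iff, mul_comm l,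
        ← div_le_iff₀ hlpos]
      exact Nat.le_ceil _
    have h2 : Real.exp (-(j * ((k + 1 : ℕ) * Real.log 2) + 2 * Real.log (k + 1 : ℕ))) =
        1 / ((((2 ^ (k + 1) : ℕ) : ℝ)) ^ j * ((k + 1 : ℕ) : ℝ) ^ 2) := by
      rw [Real.exp_neg, Real.exp_add, ← Nat.cast_ofNat (R := ℝ) (n := 2), Real.exp_nat_mul,
        Real.exp_nat_mul, Real.exp_nat_mul, Real.exp_log hk, Real.exp_log (by norm_num)]
      push_cast
      rw [one_div]
    calc (((2 ^ (k + 1) : ℕ) : ℝ)) ^ j * (C * ρ ^ N k)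
        ≤ (((2 ^ (k + 1) : ℕ) : ℝ)) ^ j *
          (C * (1 / ((((2 ^ (k + 1) : ℕ) : ℝ)) ^ j * ((k + 1 : ℕ) : ℝ) ^ 2))) := by
          rw [← h2]; gcongr
      _ = C * (1 / ((k + 1 : ℕ) : ℝ) ^ 2) := by
          field_simp
  refine ⟨(j * Real.log 2 + 4) / l + 1 + 2 / l, ?_⟩
  filter_upwards [hBC] with ω hω
  have hlog := tendsto_log_natCast_atTop
  -- Once `log (log m) ≥ 1`, the additive constants from rounding are absorbed into the `log log`
  -- term.
  filter_upwards [Nat.tendsto_log_two_atTop.eventually hω, hlog.eventually_ge_atTop 1,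
    (Real.tendsto_log_atTop.comp hlog).eventually_ge_atTop 1, eventually_ne_atTop 0]
    with m hm hm1 hm2 hm0
  simp only [not_not, Function.comp_apply] at hm hm2
  set k := Nat.log 2 m with hk
  have hH : (trieHeight X m j ω : ℝ) ≤ N k := by
    exact_mod_cast (hm.anti_balls (Nat.lt_pow_succ_log_self one_lt_two m).le).trieHeight_le
  have hN : (N k : ℝ) ≤ (j * ((k + 1 : ℕ) * Real.log 2) + 2 * Real.log (k + 1 : ℕ)) / l + 1 := by
    refine (Nat.ceil_lt_add_one (div_nonneg ?_ hlpos.le)).le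
    have : 0 ≤ Real.log (k + 1 : ℕ) := Real.log_natCast_nonneg _
    positivity
  have hkm : k * Real.log 2 ≤ Real.log m := by
    rw [← Real.log_pow]
    exact Real.log_le_log (by positivity) (by exact_mod_cast Nat.pow_log_le_self 2 hm0)
  have hlogk : Real.log (k + 1 : ℕ) ≤ 2 + Real.log (Real.log m) := by
    have h1 : ((k + 1 : ℕ) : ℝ) ≤ 3 * Real.log m := by
      push_cast
      have := Real.log_two_gt_d9
      have hk0 : (0 : ℝ) ≤ k := Nat.cast_nonneg k
      nlinarith
    have h2 : Real.log 3 ≤ 2 := by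
      have := Real.log_le_sub_one_of_pos (x := 3) (by norm_num)
      linarith
    calc Real.log (k + 1 : ℕ) ≤ Real.log (3 * Real.log m) := Real.log_le_log (by positivity) h1
      _ = Real.log 3 + Real.log (Real.log m) := Real.log_mul (by norm_num) (by linarith)
      _ ≤ _ := by linarith
  have hlm : 0 < Real.log m := by linarith
  rw [div_le_iff₀ hlm, add_mul, mul_assoc, div_mul_cancel₀ _ hlm.ne']
  have hnum : j * ((k + 1 : ℕ) * Real.log 2) + 2 * Real.log (k + 1 : ℕ) ≤
      j * Real.log m + (j * Real.log 2 + 4) + 2 * Real.log (Real.log m) := by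
    have := mul_le_mul_of_nonneg_left hkm (Nat.cast_nonneg (α := ℝ) j)
    push_cast at hlogk ⊢
    linarith
  have hdiv := div_le_div_of_nonneg_right hnum hlpos.le
  have hc : 0 ≤ (j * Real.log 2 + 4) / l + 1 := by
    have := Real.log_pos (one_lt_two (α := ℝ))
    positivity
  calc (trieHeight X m j ω : ℝ)
      ≤ (j * Real.log m + (j * Real.log 2 + 4) + 2 * Real.log (Real.log m)) / l + 1 := by linarith
    _ = j / l * Real.log m + (((j * Real.log 2 + 4) / l + 1) * 1 +
          2 / l * Real.log (Real.log m)) := by ring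
    _ ≤ j / l * Real.log m + (((j * Real.log 2 + 4) / l + 1) * Real.log (Real.log m) +
          2 / l * Real.log (Real.log m)) := by gcongr
    _ = _ := by ring

lemma ae_eventually_le_trieHeight (hρ : 0 < ρ) (hρ1 : ρ < 1) (hj : 0 < j) {c K : ℝ} (hc : 0 < c)
    (hK : 0 < K) (hlow : ∀ (b n : ℕ) (L : ℝ), 0 < L → L ^ j ≤ (b : ℝ) ^ j * (c * ρ ^ n) →
      μ.real {ω | AllBoxesLt X (j * b) j n ω} ≤ K / L)
    (hex : ∀ᵐ ω ∂μ, ∀ m : ℕ, ∃ n : ℕ, AllBoxesLt X m j n ω) {ε : ℝ} (hε : 0 < ε) (hε1 : ε < 1) :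
    ∀ᵐ ω ∂μ, ∀ᶠ m : ℕ in atTop,
      (1 - ε) * (j / (-Real.log ρ)) * (1 - Real.log (2 * j) / Real.log m) ≤
        (trieHeight X m j ω : ℝ) / Real.log m := by
  set l := -Real.log ρ with hl
  have hlpos : 0 < l := neg_pos.2 (Real.log_neg hρ hρ1)
  have hj0 : (0 : ℝ) < j := by exact_mod_cast hj
  have hlog2 : 0 < Real.log 2 := Real.log_pos one_lt_two
  -- Below the threshold by the factor `1 - ε`, so `L` may grow like `2 ^ (ε * k)` and the failure
  -- probabilities are geometric.
  let N : ℕ → ℕ := fun k => ⌊(1 - ε) * (j * (k * Real.log 2)) / l⌋₊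
  have hBC : ∀ᵐ ω ∂μ, ∀ᶠ k in atTop, ω ∉ {ω | AllBoxesLt X (j * 2 ^ k) j (N k) ω} := by
    -- Capping at `1` ensures `c' ^ j ≤ c`, so the constant can be placed inside `L ^ j`.
    set c' := min c 1 with hc'
    have hc'0 : 0 < c' := lt_min hc one_pos
    set q := Real.exp (-(ε * Real.log 2)) with hq
    have hq1 : q < 1 := Real.exp_lt_one_iff.2 (neg_lt_zero.2 (by positivity))
    have hs : Summable fun k : ℕ => K / c' * q ^ k :=
      (summable_geometric_of_lt_one (Real.exp_pos _).le hq1).mul_left _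
    refine ae_eventually_notMem_of_summable hs fun k => ?_
    have hL : 0 < c' * Real.exp (k * (ε * Real.log 2)) := by positivity
    refine (hlow (2 ^ k) (N k) _ hL ?_).trans_eq ?_
    · have h1 : Real.exp (-((1 - ε) * (j * (k * Real.log 2)))) ≤ ρ ^ N k := by
        rw [pow_eq_exp_neg_log hρ, ← hl, Real.exp_le_exp, neg_le_neg_iff, mul_comm l,
          ← le_div_iff₀ hlpos]
        refine Nat.floor_le (div_nonneg (mul_nonneg (by linarith) (by positivity)) hlpos.le)
      have h2 : (((2 ^ k : ℕ) : ℝ)) ^ j = Real.exp (j * (k * Real.log 2)) := by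
        rw [Real.exp_nat_mul, Real.exp_nat_mul, Real.exp_log two_pos]
        push_cast
        rfl
      have h3 : c' ^ j ≤ c := (pow_le_of_le_one hc'0.le (min_le_right _ _) hj.ne').trans
        (min_le_left _ _)
      calc (c' * Real.exp (k * (ε * Real.log 2))) ^ j
          = c' ^ j * Real.exp (j * (k * (ε * Real.log 2))) := by
            rw [mul_pow, ← Real.exp_nat_mul _ j]
        _ ≤ c * Real.exp (j * (k * (ε * Real.log 2))) := by gcongr
        _ = Real.exp (j * (k * Real.log 2)) *
            (c * Real.exp (-((1 - ε) * (j * (k * Real.log 2))))) := by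
          rw [mul_left_comm _ c, ← Real.exp_add]
          congr 2
          ring
        _ ≤ _ := by rw [h2]; gcongr
    · rw [hq, ← Real.exp_nat_mul, mul_neg, Real.exp_neg]
      field_simp
  filter_upwards [hBC, hex] with ω hω hexω
  have hkt : Tendsto (fun m : ℕ => Nat.log 2 (m / j)) atTop atTop :=
    Nat.tendsto_log_two_atTop.comp (Nat.tendsto_div_const_atTop hj.ne')
  have hlog := tendsto_log_natCast_atTop
  filter_upwards [hkt.eventually hω, hlog.eventually_ge_atTop 1, eventually_ge_atTop j]
    with m hm hm1 hmj
  -- This `k` satisfies `j * 2 ^ k ≤ m < j * 2 ^ (k + 1)`; the rounding loss is the term `log (2 *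
  -- j)`.
  set k := Nat.log 2 (m / j) with hk
  have hdiv0 : m / j ≠ 0 := (Nat.div_pos hmj hj).ne'
  have hle : j * 2 ^ k ≤ m :=
    (Nat.mul_le_mul_left j (Nat.pow_log_le_self 2 hdiv0)).trans (Nat.mul_div_le m j)
  have hlt : m < j * 2 ^ (k + 1) := by
    have := Nat.lt_pow_succ_log_self one_lt_two (m / j)
    rw [mul_comm]
    exact (Nat.div_lt_iff_lt_mul hj).1 this
  have hH : N k < trieHeight X m j ω :=
    lt_trieHeight (hexω m) fun h => hm (h.anti_balls hle)
  have hH' : (1 - ε) * (j * (k * Real.log 2)) / l ≤ trieHeight X m j ω :=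
    (Nat.lt_floor_add_one _).le.trans (by exact_mod_cast hH)
  have hlm : 0 < Real.log m := by linarith
  have hlogm : Real.log m ≤ Real.log (2 * j) + k * Real.log 2 := by
    have hm0 : (0 : ℝ) < m := by exact_mod_cast hj.trans_le hmj
    rw [← Real.log_pow, ← Real.log_mul (by positivity) (by positivity)]
    refine Real.log_le_log hm0 ?_
    have : (m : ℝ) ≤ j * 2 ^ (k + 1) := by exact_mod_cast hlt.le
    rw [pow_succ] at this
    linarith
  rw [le_div_iff₀ hlm, mul_assoc, sub_mul 1 _ (Real.log m), div_mul_cancel₀ _ hlm.ne', one_mul]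
  refine le_trans ?_ hH'
  calc (1 - ε) * (j / l) * (Real.log m - Real.log (2 * j))
      ≤ (1 - ε) * (j / l) * (k * Real.log 2) :=
        mul_le_mul_of_nonneg_left (by linarith) (mul_nonneg (by linarith) (by positivity))
    _ = _ := by ring

/-- A sequence with logarithmic bounds around `a` converges to `a`. -/
lemma tendsto_of_log_bounds {h : ℕ → ℝ} {a B D : ℝ}
    (hupper : ∀ᶠ m : ℕ in atTop, h m ≤ a + D * (Real.log (Real.log m) / Real.log m))
    (hlower : ∀ i : ℕ, ∀ᶠ m : ℕ in atTop,
      (1 - 1 / ((i : ℝ) + 2)) * a * (1 - B / Real.log m) ≤ h m) :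
    Tendsto h atTop (𝓝 a) := by
  have hlog := tendsto_log_natCast_atTop
  rw [tendsto_order]
  constructor
  · intro a' ha'
    have h1 : Tendsto (fun i : ℕ => (1 - 1 / ((i : ℝ) + 2)) * a) atTop (𝓝 ((1 - 0) * a)) := by
      refine (tendsto_const_nhds.sub ?_).mul_const a
      refine Tendsto.div_atTop tendsto_const_nhds ?_
      exact tendsto_atTop_add_const_right _ _ tendsto_natCast_atTop_atTop
    rw [sub_zero, one_mul] at h1
    obtain ⟨i, hi⟩ := (h1.eventually_const_lt ha').exists
    have h2 : Tendsto (fun m : ℕ => (1 - 1 / ((i : ℝ) + 2)) * a * (1 - B / Real.log m)) atTop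
        (𝓝 ((1 - 1 / ((i : ℝ) + 2)) * a * (1 - 0))) :=
      (tendsto_const_nhds.sub (Tendsto.div_atTop tendsto_const_nhds hlog)).const_mul _
    rw [sub_zero, mul_one] at h2
    filter_upwards [h2.eventually_const_lt hi, hlower i] with m hm1 hm2
    exact hm1.trans_le hm2
  · intro a' ha'
    have h1 : Tendsto (fun m : ℕ => a + D * (Real.log (Real.log m) / Real.log m)) atTop
        (𝓝 (a + D * 0)) :=
      tendsto_const_nhds.add
        ((Real.isLittleO_log_id_atTop.tendsto_div_nhds_zero.comp hlog).const_mul D)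
    rw [mul_zero, add_zero] at h1
    filter_upwards [h1.eventually_lt_const ha', hupper] with m hm1 hm2
    exact hm2.trans_lt hm1

end HeightAsymptotics

/-! ### Assembly of the spectral and probabilistic estimates. -/

theorem theorem1 {Ω S : Type*} [MeasurableSpace Ω] (μ : Measure Ω) [IsProbabilityMeasure μ]
    [Fintype S] [DecidableEq S] [Nontrivial S] [MeasurableSpace S] [MeasurableSingletonClass S]
    (P : Matrix S S ℝ) (hP : P ∈ Matrix.rowStochastic ℝ S) (hirr : P.IsIrreducible)
    (haper : IsAperiodic P)
    (ν : S → ℝ) (hν : ν ∈ stdSimplex ℝ S)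
    (X : ℕ → ℕ → Ω → S) (hX : ∀ k, IsMarkovChain μ ν P (X k))
    (hindep : iIndepFun (fun (k : ℕ) (ω : Ω) (t : ℕ) => X k t ω) μ)
    (j : ℕ) (hj : 2 ≤ j) :
    ∃ ρ : ℝ,
      IsMaxModulusEigenvalue (Matrix.of fun i k : S => ((P i k ^ j : ℝ) : ℂ)) (ρ : ℂ) ∧
      0 < ρ ∧ ρ < 1 ∧
      (∀ᵐ ω ∂μ, ∀ m : ℕ, ∃ n : ℕ, AllBoxesLt X m j n ω) ∧
      (∀ᵐ ω ∂μ, Tendsto (fun m : ℕ => (trieHeight X m j ω : ℝ) / Real.log m) atTop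
        (𝓝 ((j : ℝ) / (-Real.log ρ)))) ∧
      (∃ C : ℝ, ∀ᵐ ω ∂μ, ∀ᶠ m : ℕ in atTop,
        (trieHeight X m j ω : ℝ) / Real.log m ≤
          (j : ℝ) / (-Real.log ρ) + C * (Real.log (Real.log m) / Real.log m)) := by
  have hP0 := hirr.nonneg
  have hj0 : 0 < j := by omega
  obtain ⟨ρ, hmax, hρ, hρ1, v, hv, hPv⟩ :=
    exists_maxModulusEigenvalue_hadamardPow hP (haper.isPrimitive hirr) hj
  obtain ⟨c, C, hc, hC, hcC⟩ := sum_wordProb_pow_bounds hν hP0 hρ hv hPv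
  have hm : ∀ k t, Measurable (X k t) := fun k t => (hX k).measurable t
  have hp : ∀ n k (u : Fin n → S), μ.real {ω | (fun t : Fin n => X k t ω) = u} = wordProb ν P n u :=
    fun n k u => (hX k).measureReal_prefix hν.1 hP0 n u
  have hup : ∀ m n : ℕ, μ.real {ω | ¬ AllBoxesLt X m j n ω} ≤ (m : ℝ) ^ j * (C * ρ ^ n) :=
    fun m n => (measureReal_not_allBoxesLt_le hindep (hp n) m j).trans
      (mul_le_mul_of_nonneg_left (hcC n).2 (by positivity))
  have hlow : ∀ (b n : ℕ) (L : ℝ), 0 < L → L ^ j ≤ (b : ℝ) ^ j * (c * ρ ^ n) →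
      μ.real {ω | AllBoxesLt X (j * b) j n ω} ≤ 2 ^ (j + 1) / L :=
    fun b n L hL hLb => measureReal_allBoxesLt_le hm hindep (hp n) hj0 b hL
      (hLb.trans (mul_le_mul_of_nonneg_left (hcC n).1 (by positivity)))
  have hex := ae_exists_allBoxesLt hρ hρ1 hup
  obtain ⟨D, hD⟩ := ae_eventually_trieHeight_le hρ hρ1 hC hup
  refine ⟨ρ, hmax, hρ, hρ1, hex, ?_, D, hD⟩
  -- Taking `ε = 1 / (i + 2)`, which is less than `1`, needs only countably many null sets.
  have hlower : ∀ᵐ ω ∂μ, ∀ i : ℕ, ∀ᶠ m : ℕ in atTop,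
      (1 - 1 / ((i : ℝ) + 2)) * (j / (-Real.log ρ)) * (1 - Real.log (2 * j) / Real.log m) ≤
        (trieHeight X m j ω : ℝ) / Real.log m :=
    ae_all_iff.2 fun i => ae_eventually_le_trieHeight hρ hρ1 hj0 hc (by positivity) hlow hex
      (by positivity) (by
        rw [div_lt_one (by positivity)]
        have := Nat.cast_nonneg (α := ℝ) i
        linarith)
  filter_upwards [hD, hlower] with ω h1 h2
  exact tendsto_of_log_bounds h1 h2
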